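/- **Conventions.** Let $\pi\in S_n$ be Grassmannian, i.e. $\pi$ has at most one descent $d$ (an index with $\pi(d)>\pi(d+1)$). Matrix positions $(i,j)$ are row $i$ from the top, column $j$ from the left, $1\le i,j\le n$. *Bumpless pipe dreams.* A bumpless pipe dream (BPD) of size $n$ is a tiling of the $n\times n$ grid by the six tiles: cross, horizontal, vertical, r-elbow (joining its south and east sides), j-elbow (joining its west and north sides), blank, forming $n$ pipes that travel from the south border to the east border. Replacing r-elbows by $1$, j-elbows by $-1$ and all other tiles by $0$ is a bijection from BPDs to $n\times n$ alternating sign matrices (ASM). Label the pipes $1,\dots,n$ from left to right on the south border. The permutation of a BPD is read from the pipe labels on the east border from top to bottom, where, if two pipes cross more than once, all of their crossings after the first one (along the pipes from the south to the east border) are ignored. $\mathrm{ASM}(\pi)$ is the set of ASMs whose BPD has permutation $\pi$. A simple droop changes a $2\times2$ square with an r-elbow in the north-west and a blank tile in the south-east: the pipe through the north-west tile is pushed through the south-east tile, so that the north-west tile becomes blank and the south-east tile becomes a j-elbow (the south-west tile changes from vertical to r-elbow or from j-elbow to horizontal; the north-east tile changes from horizontal to r-elbow or from j-elbow to vertical).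 $\mathrm{droop}(\pi)$ is the poset of all BPDs obtained by simple droops from the Rothe BPD of $\pi$ (the BPD whose ASM has the $1$s at the positions $(i,\pi(i))$); each simple droop moves up. *Pipe dreams.* A pipe dream (PD) of size $n$ places cross-tiles at some positions $(i,j)$ with $i+j\le n$ and elbow-tiles (joining north with west, and south with east) at all others. Its $n$ pipes enter at the north border, labelled $1,\dots,n$ from left to right, and exit at the west border. It is reduced if no two pipes cross twice; its permutation is then read from the labels on the west border from top to bottom. A simple slide moves a cross-tile from the south-west to the north-east corner of a $2\times2$ square whose other three tiles are elbow-tiles. $\mathrm{slide}(\pi)$ is the poset of all PDs obtained by simple slides from the bottom PD of $\pi$ (the reduced PD with permutation $\pi$ whose crosses are left-justified); each simple slide moves up. $\mathrm{slide}(\pi)^*$ is the dual poset. *TSSCPP.* A TSSCPP $t$ of order $n$ is a totally symmetric self-complementary plane partition in a $2n\times 2n\times 2n$ box. For $1\le j\le n-1$ and $\delta\ge0$ let $E_j(\delta)$ be the number of $x\ge1$ with $t_{n+x,\,n+x+\delta}\ge j$. Its boolean triangle, which records the steps of its nest of non-intersecting lattice paths, is $b_{i,n-j}=1$ if $E_j(n-i-1)=E_j(n-i)$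 and $b_{i,n-j}=0$ otherwise ($1\le j\le i\le n-1$). Its pipe dream has a cross-tile at $(r,c)$, $r+c\le n$, exactly if $b_{n-r,\,r+c-1}=1$. $\mathrm{TSSCPP}^{red}(\pi)$ is the set of TSSCPP of order $n$ whose pipe dream is reduced with permutation $\pi$. **Statement.** There is a bijection $f:\mathrm{ASM}(\pi)\to\mathrm{TSSCPP}^{red}(\pi)$ which, under the identifications of ASMs with their BPDs and of TSSCPPs with their PDs, is an isomorphism of posets $$\mathrm{droop}(\pi)\;\cong\;\mathrm{slide}(\pi)^*;$$ that is, the BPDs of the elements of $\mathrm{ASM}(\pi)$ are exactly the elements of $\mathrm{droop}(\pi)$, the PDs of the elements of $\mathrm{TSSCPP}^{red}(\pi)$ are exactly the elements of $\mathrm{slide}(\pi)$, and the map induced by $f$ is an order isomorphism $\mathrm{droop}(\pi)\to\mathrm{slide}(\pi)^*$. Moreover $f$ is explicit: if $\pi$ has the descent $d$, then all blank tiles of the BPD of $A\in\mathrm{ASM}(\pi)$ lie in rows $1,\dots,d$, and the PD of $f(A)$ has its cross-tiles exactly at the positions $(d+1-i,\,j)$ for which $(i,j)$ is a blank tile of the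 BPD of $A$. (If $\pi$ has no descent, both sets have one element.) -/

import Mathlib

/-! Conventions: rows are numbered from top to bottom, columns from left to right, everything
starting from `0`. A permutation `π` of `Fin n` is the word `π 0, π 1, …, π (n-1)`. -/

namespace PipeASM

/-! ### Grassmannian permutations -/

/-- `π` has a descent at `d`, that is, `π d > π (d+1)`. -/
def IsDescent {n : ℕ} (π : Equiv.Perm (Fin n)) (d : ℕ) : Prop :=
  ∃ h : d + 1 < n, π ⟨d + 1, h⟩ < π ⟨d, Nat.lt_of_succ_lt h⟩

/-- A permutation is Grassmannian if it has at most one descent. -/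
def IsGrassmannian {n : ℕ} (π : Equiv.Perm (Fin n)) : Prop :=
  ∀ d d' : ℕ, IsDescent π d → IsDescent π d' → d = d'

/-! ### Alternating sign matrices -/

/-- Entries in `{0, 1, -1}`, rows and columns sum to `1`, and the nonzero entries alternate in sign
along each row and each column (consecutive nonzero entries are opposite). -/
structure IsASM {n : ℕ} (A : Matrix (Fin n) (Fin n) ℤ) : Prop where
  entries : ∀ i j, A i j = 0 ∨ A i j = 1 ∨ A i j = -1
  row_sum : ∀ i, ∑ j, A i j = 1
  col_sum : ∀ j, ∑ i, A i j = 1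
  row_alt : ∀ i j k, j < k → A i j ≠ 0 → A i k ≠ 0 →
    (∀ l, j < l → l < k → A i l = 0) → A i k = - A i j
  col_alt : ∀ j i k, i < k → A i j ≠ 0 → A k j ≠ 0 →
    (∀ l, i < l → l < k → A l j = 0) → A k j = - A i j

/-- The type of `n × n` alternating sign matrices. -/
def ASM (n : ℕ) : Type := {A : Matrix (Fin n) (Fin n) ℤ // IsASM A}

/-! ### Bumpless pipe dreams -/

/-- The six tiles of a bumpless pipe dream. `rElbow` joins the south and the east side of the tile,
`jElbow` joins the west and the north side. -/
inductive BTile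
  | cross | horizontal | vertical | rElbow | jElbow | blank
  deriving DecidableEq

/-- Does a pipe meet the north side of the tile? -/
def BTile.north : BTile → Bool
  | .cross | .vertical | .jElbow => true
  | _ => false

/-- Does a pipe meet the south side of the tile? -/
def BTile.south : BTile → Bool
  | .cross | .vertical | .rElbow => true
  | _ => false

/-- Does a pipe meet the east side of the tile? -/
def BTile.east : BTile → Bool
  | .cross | .horizontal | .rElbow => true
  | _ => false

/-- Does a pipe meet the west side of the tile? -/
def BTile.west : BTile → Bool
  | .cross | .horizontal | .jElbow => true
  | _ => false

/-- A bumpless pipe dream of size `n`: a tiling of the `n × n` grid by the six tiles in which the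
pipes of adjacent tiles fit together, a pipe meets every edge of the south and of the east border,
and none meets the north or the west border; hence there are `n` pipes, which travel from the
south border to the east border. (Positions outside the grid carry the value `blank`.) -/
@[ext]
structure BPD (n : ℕ) where
  tile : ℕ → ℕ → BTile
  outside : ∀ i j, n ≤ i ∨ n ≤ j → tile i j = .blank
  match_horizontal : ∀ i j, i < n → j + 1 < n → (tile i j).east = (tile i (j + 1)).west
  match_vertical : ∀ i j, i + 1 < n → j < n → (tile i j).south = (tile (i + 1) j).north
  border_west : ∀ i, i < n → (tile i 0).west = false
  border_north : ∀ j, j < n → (tile 0 j).north = false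
  border_east : ∀ i, i < n → (tile i (n - 1)).east = true
  border_south : ∀ j, j < n → (tile (n - 1) j).south = true

/-- The positions of the blank tiles. -/
def BPD.blanks {n : ℕ} (D : BPD n) : Finset (ℕ × ℕ) :=
  (Finset.range n ×ˢ Finset.range n).filter fun p => D.tile p.1 p.2 = .blank

/-- The matrix entry that replaces a tile. -/
def BTile.sign : BTile → ℤ
  | .rElbow => 1
  | .jElbow => -1
  | _ => 0

/-- The alternating sign matrix corresponding to a bumpless pipe dream. -/
def BPD.toMatrix {n : ℕ} (D : BPD n) : Matrix (Fin n) (Fin n) ℤ :=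
  Matrix.of fun i j => (D.tile i j).sign

/-- Pipes are labelled by their column on the south border. Given the labels `S j` on the south
sides of the tiles of row `i`, this is the label on the west side of the tile `(i, j)` (and, for
`j = n`, the label on the east border); it is meaningful where a pipe meets that side.

At a cross-tile, the two pipes have not crossed before exactly if the pipe arriving from the west
has the smaller label: it then leaves to the east. If they have crossed before, the new crossing is
ignored, that is, the tile is treated as if the two pipes touched without crossing. In both cases
the smaller label leaves to the east and the larger one to the north. For a reduced bumpless pipe
dream (no two pipes cross twice) this just follows the pipes; in general it computes the
Demazure product. -/
def BPD.westLabel {n : ℕ} (D : BPD n) (S : ℕ → ℕ) (i : ℕ) : ℕ → ℕ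
  | 0 => 0
  | j + 1 =>
    match D.tile i j with
    | .horizontal => D.westLabel S i j
    | .cross => min (S j) (D.westLabel S i j)
    | .rElbow => S j
    | _ => 0

/-- The label on the horizontal edge in column `j` that lies `k` rows above the south border, i.e.
on the south side of the tile `(n - 1 - k, j)`. -/
def BPD.southLabel {n : ℕ} (D : BPD n) : ℕ → ℕ → ℕ
  | 0, j => j
  | k + 1, j =>
    match D.tile (n - 1 - k) j with
    | .vertical => D.southLabel k j
    | .cross => max (D.southLabel k j) (D.westLabel (D.southLabel k) (n - 1 - k) j)
    | .jElbow => D.westLabel (D.southLabel k) (n - 1 - k) j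
    | _ => 0

/-- The permutation of `D` is `π`: reading the labels on the east border from top to bottom gives
the word of `π`. -/
def BPD.HasPerm {n : ℕ} (D : BPD n) (π : Equiv.Perm (Fin n)) : Prop :=
  ∀ i : Fin n, D.westLabel (D.southLabel (n - 1 - i)) i n = π i

/-- `ASM(π)`: the alternating sign matrices whose bumpless pipe dream has permutation `π`. -/
def ASMOf {n : ℕ} (π : Equiv.Perm (Fin n)) : Type :=
  {A : ASM n // ∃ D : BPD n, D.toMatrix = A.1 ∧ D.HasPerm π}

/-- `D'` arises from `D` by a simple droop: inside a `2 × 2` square, the pipe that turns in the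
north-west tile is pushed into the blank south-east tile. It may enter the square from the south or
from the west, and leave it to the east or to the north. -/
def SimpleDroop {n : ℕ} (D D' : BPD n) : Prop :=
  ∃ i j : ℕ, i + 1 < n ∧ j + 1 < n ∧
    D.tile i j = .rElbow ∧ D'.tile i j = .blank ∧
    D.tile (i + 1) (j + 1) = .blank ∧ D'.tile (i + 1) (j + 1) = .jElbow ∧
    (D.tile (i + 1) j = .vertical ∧ D'.tile (i + 1) j = .rElbow ∨
      D.tile (i + 1) j = .jElbow ∧ D'.tile (i + 1) j = .horizontal) ∧
    (D.tile i (j + 1) = .horizontal ∧ D'.tile i (j + 1) = .rElbow ∨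
      D.tile i (j + 1) = .jElbow ∧ D'.tile i (j + 1) = .vertical) ∧
    ∀ k l : ℕ, ¬ ((k = i ∨ k = i + 1) ∧ (l = j ∨ l = j + 1)) → D'.tile k l = D.tile k l

/-- The Rothe bumpless pipe dream of `π` corresponds to the permutation matrix of `π`. -/
def BPD.IsRothe {n : ℕ} (D : BPD n) (π : Equiv.Perm (Fin n)) : Prop :=
  D.toMatrix = Matrix.of fun i j => if π i = j then 1 else 0

/-- `D` arises from the Rothe bumpless pipe dream of `π` by simple droops. -/
def InDroop {n : ℕ} (π : Equiv.Perm (Fin n)) (D : BPD n) : Prop :=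
  ∃ R : BPD n, R.IsRothe π ∧ Relation.ReflTransGen SimpleDroop R D

/-- The underlying set of `droop(π)`. -/
def DroopPoset {n : ℕ} (π : Equiv.Perm (Fin n)) : Type := {D : BPD n // InDroop π D}

theorem antisymm_of_rank {α : Type*} {r : α → α → Prop} (μ : α → ℕ)
    (h : ∀ a b, r a b → μ a < μ b) {a b : α}
    (hab : Relation.ReflTransGen r a b) (hba : Relation.ReflTransGen r b a) : a = b := by
  have key : ∀ {x y : α}, Relation.ReflTransGen r x y → μ x ≤ μ y := by
    intro x y hxy
    induction hxy with
    | refl => exact le_rfl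
    | tail _ hr ih => exact ih.trans (h _ _ hr).le
  rcases Relation.ReflTransGen.cases_head hab with rfl | ⟨c, hac, hcb⟩
  · rfl
  · have h1 := h _ _ hac
    have h2 := key hcb
    have h3 := key hba
    omega

theorem SimpleDroop.blanks_eq {n : ℕ} {D D' : BPD n} (h : SimpleDroop D D') :
    ∃ i j : ℕ, (i, j) ∉ D'.blanks.erase (i, j) ∧ (i + 1, j + 1) ∉ D'.blanks.erase (i, j) ∧
      (i, j) ∈ D'.blanks ∧ D.blanks = insert (i + 1, j + 1) (D'.blanks.erase (i, j)) := by
  obtain ⟨i, j, hi, hj, h1, h2, h3, h4, h5, h6, h7⟩ := h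
  refine ⟨i, j, by simp, by simp [BPD.blanks, h4], ?_, ?_⟩
  · simp only [BPD.blanks, Finset.mem_filter, Finset.mem_product, Finset.mem_range]
    exact ⟨⟨by omega, by omega⟩, h2⟩
  · ext ⟨k, l⟩
    simp only [BPD.blanks, Finset.mem_filter, Finset.mem_product, Finset.mem_range,
      Finset.mem_insert, Finset.mem_erase, Prod.mk.injEq, ne_eq]
    by_cases hkl : (k = i ∨ k = i + 1) ∧ (l = j ∨ l = j + 1)
    · obtain ⟨rfl | rfl, rfl | rfl⟩ := hkl
      · simp [h1]
      · rcases h6 with h6 | h6 <;> simp [h6.1, h6.2]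
      · rcases h5 with h5 | h5 <;> simp [h5.1, h5.2]
      · simp [h3, hi, hj]
    · rw [h7 k l hkl]
      have ha : ¬ (k = i + 1 ∧ l = j + 1) := fun ⟨a, b⟩ => hkl ⟨Or.inr a, Or.inr b⟩
      have hb : ¬ (k = i ∧ l = j) := fun ⟨a, b⟩ => hkl ⟨Or.inl a, Or.inl b⟩
      simp [ha, hb]

theorem SimpleDroop.rank_lt {n : ℕ} {D D' : BPD n} (h : SimpleDroop D D') :
    ∑ p ∈ D'.blanks, p.1 < ∑ p ∈ D.blanks, p.1 := by
  obtain ⟨i, j, h1, h2, h3, h4⟩ := h.blanks_eq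
  rw [h4, Finset.sum_insert h2, ← Finset.insert_erase h3, Finset.sum_insert h1]
  simp

/-- The order of `droop(π)`: the Rothe bumpless pipe dream is the bottom element, and each simple
droop moves up. -/
instance DroopPoset.instPartialOrder {n : ℕ} (π : Equiv.Perm (Fin n)) :
    PartialOrder (DroopPoset π) where
  le D D' := Relation.ReflTransGen SimpleDroop D.1 D'.1
  le_refl _ := Relation.ReflTransGen.refl
  le_trans _ _ _ h h' := h.trans h'
  le_antisymm D D' h h' := by
    refine Subtype.ext (antisymm_of_rank (r := fun a b => SimpleDroop b a)
      (fun D : BPD n => ∑ p ∈ D.blanks, p.1) (fun a b hab => SimpleDroop.rank_lt hab) ?_ ?_)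
    · exact Relation.reflTransGen_swap.mp h'
    · exact Relation.reflTransGen_swap.mp h

/-! ### Pipe dreams -/

/-- A pipe dream of size `n`, given by the positions of its cross-tiles, all strictly above the main
antidiagonal of the `n × n` grid; all other tiles are elbow-tiles. -/
@[ext]
structure PipeDream (n : ℕ) where
  crosses : Finset (ℕ × ℕ)
  above : ∀ p ∈ crosses, p.1 + p.2 + 1 < n

/-- Pipes enter at the north border, labelled by their column. An elbow-tile joins its north side
with its west side, and its east side with its south side. Given the labels `T j` on the north sides
of the tiles of row `i`, this is the label on the west side of the tile `(i, n - l)`, i.e. on the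
vertical edge at distance `l` from the east border. Labels matter only on or above the main
antidiagonal. -/
def PipeDream.sideLabel {n : ℕ} (D : PipeDream n) (T : ℕ → ℕ) (i : ℕ) : ℕ → ℕ
  | 0 => 0
  | l + 1 => if (i, n - 1 - l) ∈ D.crosses then D.sideLabel T i l else T (n - 1 - l)

/-- The label on the north side of the tile `(i, j)`. -/
def PipeDream.northLabel {n : ℕ} (D : PipeDream n) : ℕ → ℕ → ℕ
  | 0, j => j
  | i + 1, j =>
    if (i, j) ∈ D.crosses then D.northLabel i j else D.sideLabel (D.northLabel i) i (n - 1 - j)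

/-- The two pipes meeting at the tile `p` (from the north and from the east). -/
def PipeDream.pipesAt {n : ℕ} (D : PipeDream n) (p : ℕ × ℕ) : Sym2 ℕ :=
  s(D.northLabel p.1 p.2, D.sideLabel (D.northLabel p.1) p.1 (n - 1 - p.2))

/-- No two pipes cross twice. -/
def PipeDream.IsReduced {n : ℕ} (D : PipeDream n) : Prop :=
  ∀ p ∈ D.crosses, ∀ q ∈ D.crosses, D.pipesAt p = D.pipesAt q → p = q

/-- The labels on the west border, read from top to bottom, form the word of `π`. (Used for reduced
pipe dreams.) -/
def PipeDream.HasPerm {n : ℕ} (D : PipeDream n) (π : Equiv.Perm (Fin n)) : Prop :=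
  ∀ i : Fin n, D.sideLabel (D.northLabel i) i n = π i

/-- `D'` arises from `D` by a simple slide: inside a `2 × 2` square whose only cross-tile is in the
south-west corner, that cross-tile moves to the north-east corner. -/
def SimpleSlide {n : ℕ} (D D' : PipeDream n) : Prop :=
  ∃ i j : ℕ, (i + 1, j) ∈ D.crosses ∧ (i, j) ∉ D.crosses ∧ (i, j + 1) ∉ D.crosses ∧
    (i + 1, j + 1) ∉ D.crosses ∧ D'.crosses = insert (i, j + 1) (D.crosses.erase (i + 1, j))

/-- The bottom pipe dream of `π`: the reduced pipe dream of `π` with all crosses left-justified. -/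
def PipeDream.IsBottom {n : ℕ} (D : PipeDream n) (π : Equiv.Perm (Fin n)) : Prop :=
  D.IsReduced ∧ D.HasPerm π ∧ ∀ i j : ℕ, (i, j + 1) ∈ D.crosses → (i, j) ∈ D.crosses

/-- `D` arises from the bottom pipe dream of `π` by simple slides. -/
def InSlide {n : ℕ} (π : Equiv.Perm (Fin n)) (D : PipeDream n) : Prop :=
  ∃ B : PipeDream n, B.IsBottom π ∧ Relation.ReflTransGen SimpleSlide B D

/-- The underlying set of `slide(π)`. -/
def SlidePoset {n : ℕ} (π : Equiv.Perm (Fin n)) : Type := {D : PipeDream n // InSlide π D}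

theorem SimpleSlide.rank_lt {n : ℕ} {D D' : PipeDream n} (h : SimpleSlide D D') :
    ∑ p ∈ D.crosses, p.2 < ∑ p ∈ D'.crosses, p.2 := by
  obtain ⟨i, j, h1, -, h3, -, h5⟩ := h
  have h6 : (i, j + 1) ∉ D.crosses.erase (i + 1, j) := fun h => h3 (Finset.mem_of_mem_erase h)
  rw [h5, Finset.sum_insert h6, ← Finset.add_sum_erase _ _ h1]
  simp

/-- The order of `slide(π)`: the bottom pipe dream is the bottom element, and each simple slide
moves up. -/
instance SlidePoset.instPartialOrder {n : ℕ} (π : Equiv.Perm (Fin n)) :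
    PartialOrder (SlidePoset π) where
  le D D' := Relation.ReflTransGen SimpleSlide D.1 D'.1
  le_refl _ := Relation.ReflTransGen.refl
  le_trans _ _ _ h h' := h.trans h'
  le_antisymm D D' h h' := Subtype.ext (antisymm_of_rank
    (fun D : PipeDream n => ∑ p ∈ D.crosses, p.2) (fun a b hab => SimpleSlide.rank_lt hab) h h')

/-! ### Totally symmetric self-complementary plane partitions -/

/-- A plane partition: an array of nonnegative integers, weakly decreasing along rows and columns.
It is identified with the set of points `(i, j, k)` with `k < entry i j`. -/
@[ext]
structure PlanePartition where
  entry : ℕ → ℕ → ℕ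
  anti : ∀ i j i' j', i ≤ i' → j ≤ j' → entry i' j' ≤ entry i j

namespace PlanePartition

/-- `t` lies in an `a × b × c` bounding box. -/
def InBox (t : PlanePartition) (a b c : ℕ) : Prop :=
  (∀ i j, a ≤ i ∨ b ≤ j → t.entry i j = 0) ∧ ∀ i j, t.entry i j ≤ c

def IsSymmetric (t : PlanePartition) : Prop :=
  ∀ i j, t.entry i j = t.entry j i

def IsCyclicallySymmetric (t : PlanePartition) : Prop :=
  ∀ i j k, k < t.entry i j → i < t.entry j k

/-- `t` equals its complement inside an `a × b × c` bounding box. -/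
def IsSelfComplementary (t : PlanePartition) (a b c : ℕ) : Prop :=
  ∀ i j, i < a → j < b → t.entry i j = c - t.entry (a - 1 - i) (b - 1 - j)

end PlanePartition

/-- The totally symmetric self-complementary plane partitions inside a `2n × 2n × 2n` box. -/
def TSSCPP (n : ℕ) : Type :=
  {t : PlanePartition // t.InBox (2 * n) (2 * n) (2 * n) ∧ t.IsSymmetric ∧
    t.IsCyclicallySymmetric ∧ t.IsSelfComplementary (2 * n) (2 * n) (2 * n)}

/-- A TSSCPP is determined by its fundamental domain, the entries
`u a b = entry (n + a - 1) (n + b - 1)` for `1 ≤ a ≤ b ≤ n - 1`; they satisfy `u a b ≤ n - b`.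
For each level `1 ≤ j ≤ n - 1`, the cells `(a, b)` with `u a b ≥ j` form a shifted shape inside the
shifted staircase with first row of length `n - j`. Its boundary is a lattice path of `n - j` unit
steps, each to the left or down, from the north-east corner of the staircase to the main diagonal.
For different `j` these paths form the nest of nonintersecting lattice paths of the TSSCPP.

`levelCount j d` is the number of cells of the level-`j` shape on the diagonal `b - a = d`: the row in
which the path crosses this diagonal. -/
def TSSCPP.levelCount {n : ℕ} (T : TSSCPP n) (j d : ℕ) : ℕ :=
  ((Finset.range n).filter fun x => j ≤ T.1.entry (n + x) (n + x + d)).card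

/-- The boolean triangle `b i c` (`1 ≤ i ≤ n - 1`, `n - i ≤ c ≤ n - 1`) of a TSSCPP. Its diagonal
`c = n - j` records the steps of the path of level `j`. The entry in row `i` belongs to the step
between the diagonals `n - i` and `n - i - 1`; it is `1` if this step goes to the left and `0` if it
goes down. -/
def TSSCPP.boolTriangle {n : ℕ} (T : TSSCPP n) (i c : ℕ) : ℕ :=
  if T.levelCount (n - c) (n - i - 1) = T.levelCount (n - c) (n - i) then 1 else 0

/-- The pipe dream of a TSSCPP: flip the boolean triangle vertically and justify it to the left, and
turn ones into cross-tiles and zeros into elbow-tiles. With rows and columns `r`, `c` counted from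
`1`, position `(r, c)` receives the entry `b (n - r) (r + c - 1)`. -/
def TSSCPP.toPipeDream {n : ℕ} (T : TSSCPP n) : PipeDream n where
  crosses := (Finset.range n ×ˢ Finset.range n).filter fun p =>
    p.1 + p.2 + 1 < n ∧ T.boolTriangle (n - (p.1 + 1)) ((p.1 + 1) + (p.2 + 1) - 1) = 1
  above := fun _ hp => (Finset.mem_filter.mp hp).2.1

/-- `TSSCPP^red(π)`: the TSSCPP whose pipe dream is reduced and has permutation `π`. -/
def TSSCPPRed {n : ℕ} (π : Equiv.Perm (Fin n)) : Type :=
  {T : TSSCPP n // T.toPipeDream.IsReduced ∧ T.toPipeDream.HasPerm π}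

end PipeASM

/-!
A Grassmannian permutation is treated as a permutation `p` of `ℕ` (`natPerm`) that increases on
`[0, d]` and on `(d, ∞)` (`GrassAt`). The theorem rests on a description of all bumpless pipe dreams
and all reduced pipe dreams of such a permutation by local conditions.

*Bumpless pipe dreams.* As the labels on the east border increase in the rows up to `d`, these rows
have no crosses (`BPD.no_cross_of_increasing`). Each later row leads to a smaller label than all rows
below it, which forces it to agree with the Rothe bumpless pipe dream and to contain no blank tile
(`BPD.rothe_rows`). Hence the blank tiles lie in the rows up to `d` and determine the tiling
(`BPD.HasPerm.ext_blanks`). In a crossing-free region a `jElbow` that is farthest to the north-west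
can be drooped back, and without any `jElbow` only the Rothe bumpless pipe dream is left; so
`droop(π)` consists of all bumpless pipe dreams with permutation `π` (`BPD.hasPerm_iff_inDroop`).

*Pipe dreams.* Reading the cells row by row, a cross-tile exchanges two neighbouring pipes
(`PipeDream.state`); in a reduced pipe dream every cross is therefore an inversion of the permutation
(`PipeDream.IsReduced.inversion`). As a Grassmannian permutation does not have three pairwise
inverted values, a reduced pipe dream that is not left-justified can be slid back
(`PipeDream.IsReduced.exists_unslide`); so `slide(π)` consists of all reduced pipe dreams with
permutation `π` (`PipeDream.inSlide_iff`), and its bottom element is unique (`PipeDream.IsBottom.eq`).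

*The correspondence.* Call `D` and `P` matched if the crosses of `P` are the blank tiles of `D`,
reflected in the rows up to `d`. In a crossing-free `2 × 2` square, whether a droop is possible
depends only on which tiles are blank: the south-east one must be the only one. This is the condition
under which a slide can be undone in the reflected square, and the same holds with the directions
exchanged (`Matched.exists_slide`, `Matched.exists_droop`, `Matched.exists_undroop`). The Rothe
bumpless pipe dream is matched with an explicit pipe dream, and following its labels shows that this
one is reduced with permutation `π` (`PipeDream.top`). Every element of `droop(π)` is reached from
there, and so is every element of `slide(π)`: slide back to the bottom from the one pipe dream and
up again to the other (`exists_orderIso`).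

*Plane partitions.* Reading a pipe dream as the lattice paths of a plane partition succeeds exactly
if consecutive paths do not intersect, for which it is enough that any two crosses on an antidiagonal
are separated by a cross on the preceding antidiagonal (`PipeDream.Interlaced.exists_toPipeDream`).
Left-justified pipe dreams have this property and slides preserve it, so every element of `slide(π)`
comes from exactly one plane partition (`exists_tsscpp_equiv`).
-/

namespace PipeASM

/-! ### Grassmannian permutations of the natural numbers -/

/-- The permutation of `ℕ` that extends a permutation of `Fin n` by the identity. -/
def natPerm {n : ℕ} (π : Equiv.Perm (Fin n)) : Equiv.Perm ℕ := π.extendDomain Fin.equivSubtype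

theorem natPerm_val {n : ℕ} (π : Equiv.Perm (Fin n)) (i : Fin n) : natPerm π i = π i := by
  have := Equiv.Perm.extendDomain_apply_image π Fin.equivSubtype i
  simpa [natPerm] using this

theorem natPerm_of_lt {n : ℕ} (π : Equiv.Perm (Fin n)) {i : ℕ} (h : i < n) :
    natPerm π i = π ⟨i, h⟩ := natPerm_val π ⟨i, h⟩

theorem natPerm_of_ge {n : ℕ} (π : Equiv.Perm (Fin n)) {i : ℕ} (h : n ≤ i) : natPerm π i = i :=
  Equiv.Perm.extendDomain_apply_not_subtype _ _ (by omega)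

theorem natPerm_lt {n : ℕ} (π : Equiv.Perm (Fin n)) {i : ℕ} (h : i < n) : natPerm π i < n := by
  rw [natPerm_of_lt π h]; exact (π ⟨i, h⟩).2

theorem natPerm_symm_lt {n : ℕ} (π : Equiv.Perm (Fin n)) {i : ℕ} (h : i < n) :
    (natPerm π).symm i < n := by
  by_contra hc
  have := natPerm_of_ge π (not_lt.mp hc)
  rw [Equiv.apply_symm_apply] at this
  omega

/-- `p` increases on `[0, d]` and on `(d, ∞)`. -/
structure GrassAt (p : Equiv.Perm ℕ) (d : ℕ) : Prop where
  top : ∀ i j, i < j → j ≤ d → p i < p j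
  bot : ∀ i j, d < i → i < j → p i < p j

theorem lt_of_not_descent {n : ℕ} {π : Equiv.Perm (Fin n)} {a b : ℕ}
    (h : ∀ c, a ≤ c → c < b → ¬ IsDescent π c) (hab : a < b) : natPerm π a < natPerm π b := by
  induction b with
  | zero => omega
  | succ b ih =>
    have step : natPerm π b < natPerm π (b + 1) := by
      by_cases hb : b + 1 < n
      · have h1 := h b (by omega) (by omega)
        simp only [IsDescent, not_exists, not_lt] at h1
        have h2 := h1 hb
        have h3 : natPerm π b ≤ natPerm π (b + 1) := by
          rw [natPerm_of_lt π hb, natPerm_of_lt π (Nat.lt_of_succ_lt hb)]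
          exact h2
        have h4 : natPerm π b ≠ natPerm π (b + 1) := fun e => by
          have := (natPerm π).injective e
          omega
        omega
      · rw [natPerm_of_ge π (not_lt.mp hb)]
        by_cases hb' : b < n
        · have := natPerm_lt π hb'; omega
        · rw [natPerm_of_ge π (not_lt.mp hb')]; omega
    rcases Nat.lt_or_ge a b with h' | h'
    · exact (ih (fun c h1 h2 => h c h1 (by omega)) h').trans step
    · obtain rfl : a = b := by omega
      exact step

theorem IsGrassmannian.grassAt {n : ℕ} {π : Equiv.Perm (Fin n)} (h : IsGrassmannian π) {d : ℕ}
    (hd : IsDescent π d) : GrassAt (natPerm π) d where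
  top _ j hij hj := lt_of_not_descent (fun c _ h2 hc => by have := h c d hc hd; omega) hij
  bot i _ hi hij := lt_of_not_descent (fun c h1 _ hc => by have := h c d hc hd; omega) hij

theorem grassAt_of_no_descent {n : ℕ} {π : Equiv.Perm (Fin n)} (h : ∀ d, ¬ IsDescent π d) :
    GrassAt (natPerm π) 0 where
  top _ _ hij _ := lt_of_not_descent (fun c _ _ => h c) hij
  bot _ _ _ hij := lt_of_not_descent (fun c _ _ => h c) hij

/-! ### Labels in a bumpless pipe dream -/

namespace BTile

@[simp] theorem north_cross : BTile.cross.north = true := rfl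
@[simp] theorem north_horizontal : BTile.horizontal.north = false := rfl
@[simp] theorem north_vertical : BTile.vertical.north = true := rfl
@[simp] theorem north_rElbow : BTile.rElbow.north = false := rfl
@[simp] theorem north_jElbow : BTile.jElbow.north = true := rfl
@[simp] theorem north_blank : BTile.blank.north = false := rfl
@[simp] theorem south_cross : BTile.cross.south = true := rfl
@[simp] theorem south_horizontal : BTile.horizontal.south = false := rfl
@[simp] theorem south_vertical : BTile.vertical.south = true := rfl
@[simp] theorem south_rElbow : BTile.rElbow.south = true := rfl
@[simp] theorem south_jElbow : BTile.jElbow.south = false := rfl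
@[simp] theorem south_blank : BTile.blank.south = false := rfl
@[simp] theorem east_cross : BTile.cross.east = true := rfl
@[simp] theorem east_horizontal : BTile.horizontal.east = true := rfl
@[simp] theorem east_vertical : BTile.vertical.east = false := rfl
@[simp] theorem east_rElbow : BTile.rElbow.east = true := rfl
@[simp] theorem east_jElbow : BTile.jElbow.east = false := rfl
@[simp] theorem east_blank : BTile.blank.east = false := rfl
@[simp] theorem west_cross : BTile.cross.west = true := rfl
@[simp] theorem west_horizontal : BTile.horizontal.west = true := rfl
@[simp] theorem west_vertical : BTile.vertical.west = false := rfl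
@[simp] theorem west_rElbow : BTile.rElbow.west = false := rfl
@[simp] theorem west_jElbow : BTile.jElbow.west = true := rfl
@[simp] theorem west_blank : BTile.blank.west = false := rfl

end BTile

namespace BPD

variable {n : ℕ}

/-- The label on the south side of the tile `(i, j)`. -/
def sl (D : BPD n) (i j : ℕ) : ℕ := D.southLabel (n - 1 - i) j

/-- The label on the west side of the tile `(i, j)`. -/
def wl (D : BPD n) (i j : ℕ) : ℕ := D.westLabel (D.sl i) i j

/-- The label on the north side of the tile `(i, j)`, computed from the labels on its other
sides. -/
def nl (D : BPD n) (i j : ℕ) : ℕ :=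
  match D.tile i j with
  | .vertical => D.sl i j
  | .cross => max (D.sl i j) (D.wl i j)
  | .jElbow => D.wl i j
  | _ => 0

/-- A pipe crosses the vertical edge on the west side of column `j` in row `i`; for `j = n` this is
the edge on the east border. -/
def HasWest (D : BPD n) (i : ℕ) : ℕ → Prop
  | 0 => False
  | j + 1 => (D.tile i j).east = true

@[simp] theorem hasWest_succ (D : BPD n) (i j : ℕ) :
    D.HasWest i (j + 1) ↔ (D.tile i j).east = true := Iff.rfl

theorem sl_last (D : BPD n) (j : ℕ) : D.sl (n - 1) j = j := by simp [sl, southLabel]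

theorem sl_eq_nl (D : BPD n) {i : ℕ} (h : i + 1 < n) (j : ℕ) : D.sl i j = D.nl (i + 1) j := by
  have h1 : n - 1 - i = (n - 1 - (i + 1)) + 1 := by omega
  have h2 : n - 1 - (n - 1 - (i + 1)) = i + 1 := by omega
  rw [sl, h1, southLabel, h2]
  rfl

theorem wl_succ (D : BPD n) (i j : ℕ) : D.wl i (j + 1) =
    match D.tile i j with
    | .horizontal => D.wl i j
    | .cross => min (D.sl i j) (D.wl i j)
    | .rElbow => D.sl i j
    | _ => 0 := rfl

theorem nl_def (D : BPD n) (i j : ℕ) : D.nl i j =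
    match D.tile i j with
    | .vertical => D.sl i j
    | .cross => max (D.sl i j) (D.wl i j)
    | .jElbow => D.wl i j
    | _ => 0 := rfl

theorem hasPerm_iff (D : BPD n) (π : Equiv.Perm (Fin n)) :
    D.HasPerm π ↔ ∀ i < n, D.wl i n = natPerm π i := by
  constructor
  · intro h i hi
    rw [natPerm_of_lt π hi]
    exact h ⟨i, hi⟩
  · intro h i
    rw [← natPerm_val]
    exact h i i.2

theorem west_iff (D : BPD n) {i j : ℕ} (hi : i < n) (hj : j < n) :
    (D.tile i j).west = true ↔ D.HasWest i j := by
  cases j with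
  | zero => simp [HasWest, D.border_west i hi]
  | succ j => simp [HasWest, D.match_horizontal i j hi hj]

theorem hasWest_last (D : BPD n) {i : ℕ} (hi : i < n) : D.HasWest i n := by
  obtain ⟨m, rfl⟩ : ∃ m, n = m + 1 := ⟨n - 1, by omega⟩
  exact D.border_east i hi

/-- A tile is determined by the edges on its north and west sides, together with any information
that separates `cross` from `jElbow` and `blank` from `rElbow`. Scanning from the north-west corner,
this determines the whole tiling. -/
theorem ext_of_scan {D D' : BPD n}
    (h : ∀ i j, i < n → j < n → (D.tile i j).north = (D'.tile i j).north →
      (D.tile i j).west = (D'.tile i j).west → D.tile i j = D'.tile i j) : D = D' := by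
  have key : ∀ s i j, i + j = s → i < n → j < n → D.tile i j = D'.tile i j := by
    intro s
    induction s with
    | zero =>
      intro i j hs hi hj
      obtain ⟨rfl, rfl⟩ : i = 0 ∧ j = 0 := by omega
      exact h 0 0 hi hj (by rw [D.border_north 0 hj, D'.border_north 0 hj])
        (by rw [D.border_west 0 hi, D'.border_west 0 hi])
    | succ s ih =>
      intro i j hs hi hj
      refine h i j hi hj ?_ ?_
      · cases i with
        | zero => rw [D.border_north j hj, D'.border_north j hj]
        | succ i =>
          rw [← D.match_vertical i j hi hj, ← D'.match_vertical i j hi hj,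
            ih i j (by omega) (by omega) hj]
      · cases j with
        | zero => rw [D.border_west i hi, D'.border_west i hi]
        | succ j =>
          rw [← D.match_horizontal i j hi hj, ← D'.match_horizontal i j hi hj,
            ih i j (by omega) hi (by omega)]
  ext i j
  by_cases hij : i < n ∧ j < n
  · exact key _ i j rfl hij.1 hij.2
  · rw [D.outside i j (by omega), D'.outside i j (by omega)]

theorem toMatrix_injective : Function.Injective (toMatrix : BPD n → _) := by
  intro D D' h
  refine ext_of_scan fun i j hi hj => ?_
  have h1 : (D.tile i j).sign = (D'.tile i j).sign := congrFun (congrFun h ⟨i, hi⟩) ⟨j, hj⟩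
  revert h1
  cases D.tile i j <;> cases D'.tile i j <;> simp [BTile.sign, BTile.north, BTile.west]

/-! ### The matrix of a bumpless pipe dream is an alternating sign matrix -/

theorem sign_eq_east_sub_west (t : BTile) :
    t.sign = (if t.east = true then 1 else 0) - (if t.west = true then 1 else 0) := by
  cases t <;> simp [BTile.sign, BTile.east, BTile.west]

theorem sign_eq_south_sub_north (t : BTile) :
    t.sign = (if t.south = true then 1 else 0) - (if t.north = true then 1 else 0) := by
  cases t <;> simp [BTile.sign, BTile.south, BTile.north]

theorem east_eq_west_of_sign {t : BTile} (h : t.sign = 0) : t.east = t.west := by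
  revert h; cases t <;> simp [BTile.sign, BTile.east, BTile.west]

theorem south_eq_north_of_sign {t : BTile} (h : t.sign = 0) : t.south = t.north := by
  revert h; cases t <;> simp [BTile.sign, BTile.south, BTile.north]

theorem isASM_toMatrix (D : BPD n) : IsASM D.toMatrix where
  entries i j := by
    simp only [toMatrix, Matrix.of_apply]
    cases D.tile i j <;> simp [BTile.sign]
  row_sum i := by
    have key : ∀ m, m ≤ n → m ≠ 0 → ∑ j ∈ Finset.range m, (D.tile i j).sign =
        if (D.tile i (m - 1)).east = true then 1 else 0 := by
      intro m
      induction m with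
      | zero => simp
      | succ m ih =>
        intro hm _
        rw [Finset.sum_range_succ, sign_eq_east_sub_west]
        cases m with
        | zero => simp [D.border_west i i.2]
        | succ m =>
          rw [ih (by omega) (by omega), ← D.match_horizontal i m i.2 hm]
          simp
    have h0 : n ≠ 0 := by have := i.2; omega
    have h1 := key n le_rfl h0
    rw [D.border_east i i.2, Finset.sum_range] at h1
    simpa [toMatrix] using h1
  col_sum j := by
    have key : ∀ m, m ≤ n → m ≠ 0 → ∑ i ∈ Finset.range m, (D.tile i j).sign =
        if (D.tile (m - 1) j).south = true then 1 else 0 := by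
      intro m
      induction m with
      | zero => simp
      | succ m ih =>
        intro hm _
        rw [Finset.sum_range_succ, sign_eq_south_sub_north]
        cases m with
        | zero => simp [D.border_north j j.2]
        | succ m =>
          rw [ih (by omega) (by omega), ← D.match_vertical m j hm j.2]
          simp
    have h0 : n ≠ 0 := by have := j.2; omega
    have h1 := key n le_rfl h0
    rw [D.border_south j j.2, Finset.sum_range] at h1
    simpa [toMatrix] using h1
  row_alt i j k hjk h1 h2 h3 := by
    have key : ∀ l, (j : ℕ) < l → l ≤ k → (D.tile i l).west = (D.tile i j).east := by
      intro l
      induction l with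
      | zero => omega
      | succ l ih =>
        intro hl hk
        rw [← D.match_horizontal i l i.2 (by omega)]
        rcases Nat.lt_or_ge j l with h | h
        · rw [← ih h (by omega)]
          exact east_eq_west_of_sign (h3 ⟨l, by omega⟩ h (by simp only [Fin.lt_def]; omega))
        · obtain rfl : (j : ℕ) = l := by omega
          rfl
    have h4 := key k hjk le_rfl
    simp only [toMatrix, Matrix.of_apply] at h1 h2 ⊢
    revert h1 h2 h4
    cases D.tile i j <;> cases D.tile i k <;> simp [BTile.sign, BTile.west, BTile.east]
  col_alt j i k hik h1 h2 h3 := by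
    have key : ∀ l, (i : ℕ) < l → l ≤ k → (D.tile l j).north = (D.tile i j).south := by
      intro l
      induction l with
      | zero => omega
      | succ l ih =>
        intro hl hk
        rw [← D.match_vertical l j (by omega) j.2]
        rcases Nat.lt_or_ge i l with h | h
        · rw [← ih h (by omega)]
          exact south_eq_north_of_sign (h3 ⟨l, by omega⟩ h (by simp only [Fin.lt_def]; omega))
        · obtain rfl : (i : ℕ) = l := by omega
          rfl
    have h4 := key k hik le_rfl
    simp only [toMatrix, Matrix.of_apply] at h1 h2 ⊢
    revert h1 h2 h4
    cases D.tile i j <;> cases D.tile k j <;> simp [BTile.sign, BTile.north, BTile.south]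

end BPD

/-! ### Crossing-free rows and Rothe rows -/

namespace BPD

variable {n : ℕ}

/-- If the labels on the north sides of a row increase from left to right and are smaller than the
label that leaves the row on the east border, then the row has no cross, and the labels on its
south sides increase too. Scanning from the right, the labels on the north sides not yet passed are
smaller than the label on the current vertical edge, which is smaller than the labels on the south
sides already passed; a cross would send the larger of its labels to the north. -/
theorem no_cross_row (D : BPD n) {i e : ℕ} (hi : i < n) (hw : D.wl i n = e)
    (hs : ∀ j j', j < j' → j' < n → (D.tile i j).north = true → (D.tile i j').north = true →
      D.nl i j < D.nl i j')
    (he : ∀ j, j < n → (D.tile i j).north = true → D.nl i j < e) :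
    (∀ j, j < n → D.tile i j ≠ .cross) ∧
    (∀ j j', j < j' → j' < n → (D.tile i j).south = true → (D.tile i j').south = true →
      D.sl i j < D.sl i j') ∧
    (∀ j, j < n → (D.tile i j).south = true → D.sl i j ≤ e) := by
  have key : ∀ m j, j + m = n →
      (∀ l, j ≤ l → l < n → D.tile i l ≠ .cross) ∧
      (∀ l l', j ≤ l → l < l' → l' < n → (D.tile i l).south = true →
        (D.tile i l').south = true → D.sl i l < D.sl i l') ∧
      (∀ l, j ≤ l → l < n → (D.tile i l).south = true → D.sl i l ≤ e) ∧
      (∀ l l', l < j → j ≤ l' → l' < n → (D.tile i l).north = true →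
        (D.tile i l').south = true → D.nl i l < D.sl i l') ∧
      (D.HasWest i j → D.wl i j ≤ e ∧
        (∀ l, l < j → (D.tile i l).north = true → D.nl i l < D.wl i j) ∧
        ∀ l', j ≤ l' → l' < n → (D.tile i l').south = true → D.wl i j < D.sl i l') := by
    intro m
    induction m with
    | zero =>
      intro j hj
      obtain rfl : j = n := by omega
      refine ⟨by omega, by omega, by omega, by omega, fun _ => ⟨hw.le, ?_, by omega⟩⟩
      rw [hw]
      exact he
    | succ m ih =>
      intro j hj
      obtain ⟨h1, h2, h3, h4, h5⟩ := ih (j + 1) (by omega)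
      have hjn : j < n := by omega
      have hwest := D.west_iff hi hjn
      have hwl := D.wl_succ i j
      have hnl := D.nl_def i j
      have hsplit : ∀ l, j ≤ l → l = j ∨ j + 1 ≤ l := by omega
      have hsplit' : ∀ l, l < j + 1 → l = j ∨ l < j := by omega
      cases ht : D.tile i j
      · have h6 := (h5 (by simp [ht])).2.1 j (by omega) (by simp [ht])
        simp only [ht] at hwl hnl
        rw [hwl, hnl] at h6
        exact absurd min_le_max h6.not_ge
      all_goals
        rw [ht] at hwest hwl hnl
        have hN := congrArg BTile.north ht
        have hS := congrArg BTile.south ht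
        rw [hasWest_succ, ht] at h5
        simp only [BTile.west_horizontal, BTile.west_vertical, BTile.west_rElbow,
          BTile.west_jElbow, BTile.west_blank, BTile.north_horizontal, BTile.north_vertical,
          BTile.north_rElbow, BTile.north_jElbow, BTile.north_blank, BTile.south_horizontal,
          BTile.south_vertical, BTile.south_rElbow, BTile.south_jElbow, BTile.south_blank,
          BTile.east_horizontal, BTile.east_vertical, BTile.east_rElbow,
          BTile.east_jElbow, BTile.east_blank, Bool.false_eq_true, true_iff, false_iff,
          forall_const, IsEmpty.forall_iff] at hwest hwl hnl hN hS h5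
        have hsj : ∀ l, l < j → _ := fun l hl => hs l j hl hjn
        have hej := he j hjn
        have h4j : ∀ l', j + 1 ≤ l' → _ := fun l' => h4 j l' (by omega)
        have h4' : ∀ l l', l < j → j + 1 ≤ l' → _ := fun l l' hl => h4 l l' (by omega)
        clear hw ih hs he h4
        refine ⟨?_, ?_, ?_, ?_, ?_⟩
        · intro l hl hln
          rcases hsplit l hl with rfl | hl
          · simp [ht]
          · exact h1 l hl hln
        · intro l l' hl hll hl' hS1 hS2
          rcases hsplit l hl with rfl | hl <;> grind
        · intro l hl hl' hS1
          rcases hsplit l hl with rfl | hl <;> grind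
        · intro l l' hl hl1 hl' hS1 hS2
          rcases hsplit l' hl1 with rfl | hl <;> grind
        · intro hW
          refine ⟨?_, ?_, ?_⟩
          · grind
          · intro l hl hN1
            grind
          · intro l hl hl' hS1
            rcases hsplit l hl with rfl | hl <;> grind
  obtain ⟨h1, h2, h3, -, -⟩ := key n 0 (by omega)
  exact ⟨fun j => h1 j (Nat.zero_le _), fun j j' => h2 j j' (Nat.zero_le _),
    fun j => h3 j (Nat.zero_le _)⟩

theorem north_succ_iff (D : BPD n) {i j : ℕ} (hi : i + 1 < n) (hj : j < n) :
    (D.tile (i + 1) j).north = (D.tile i j).south := (D.match_vertical i j hi hj).symm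

/-- While the labels on the east border increase, there are no crosses. -/
theorem no_cross_of_increasing (D : BPD n) {p : ℕ → ℕ} {d : ℕ} (hp : ∀ i, i < n → D.wl i n = p i)
    (hd : ∀ i j, i < j → j ≤ d → p i < p j) {i j : ℕ} (hid : i ≤ d) (hi : i < n) (hj : j < n) :
    D.tile i j ≠ .cross := by
  have key : ∀ i, i ≤ d → i < n →
      (∀ j j', j < j' → j' < n → (D.tile i j).north = true → (D.tile i j').north = true →
        D.nl i j < D.nl i j') ∧
      (∀ j, j < n → (D.tile i j).north = true → D.nl i j < p i) := by
    intro i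
    induction i with
    | zero =>
      intro _ h0
      refine ⟨fun j j' hjj hj' h => ?_, fun j hj h => ?_⟩
      · simp [D.border_north j (by omega)] at h
      · simp [D.border_north j (by omega)] at h
    | succ i ih =>
      intro hid hi
      obtain ⟨h1, h2⟩ := ih (by omega) (by omega)
      obtain ⟨-, h3, h4⟩ := D.no_cross_row (by omega) (hp i (by omega)) h1 h2
      refine ⟨fun j j' hjj hj' h h' => ?_, fun j hj h => ?_⟩
      · rw [D.north_succ_iff hi (by omega)] at h h'
        rw [← D.sl_eq_nl hi, ← D.sl_eq_nl hi]
        exact h3 j j' hjj hj' h h'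
      · rw [D.north_succ_iff hi (by omega)] at h
        rw [← D.sl_eq_nl hi]
        exact (h4 j hj h).trans_lt (hd i (i + 1) (by omega) hid)
  exact (D.no_cross_row hi (hp i hi) (key i hid hi).1 (key i hid hi).2).1 j hj

/-- The tile `(i, j)` of the Rothe bumpless pipe dream of `p`: the pipe `p i` runs upwards in
column `p i`, turns in row `i`, and runs to the east. -/
def rotheTile (p : Equiv.Perm ℕ) (i j : ℕ) : BTile :=
  if p i = j then .rElbow
  else if p i < j then (if p.symm j < i then .cross else .horizontal)
  else (if p.symm j < i then .vertical else .blank)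

theorem rotheTile_south (p : Equiv.Perm ℕ) (i j : ℕ) :
    (rotheTile p i j).south = decide (p.symm j ≤ i) := by
  have h : p i = j ↔ p.symm j = i := by rw [Equiv.symm_apply_eq, eq_comm]
  unfold rotheTile
  split_ifs <;> simp [BTile.south] <;> omega

theorem rotheTile_north (p : Equiv.Perm ℕ) (i j : ℕ) :
    (rotheTile p i j).north = decide (p.symm j < i) := by
  have h : p i = j ↔ p.symm j = i := by rw [Equiv.symm_apply_eq, eq_comm]
  unfold rotheTile
  split_ifs <;> simp [BTile.north] <;> omega

theorem rotheTile_east (p : Equiv.Perm ℕ) (i j : ℕ) :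
    (rotheTile p i j).east = decide (p i ≤ j) := by
  unfold rotheTile
  split_ifs <;> simp [BTile.east] <;> omega

theorem rotheTile_west (p : Equiv.Perm ℕ) (i j : ℕ) :
    (rotheTile p i j).west = decide (p i < j) := by
  unfold rotheTile
  split_ifs <;> simp [BTile.west] <;> omega

/-- Suppose that every pipe entering row `i` from below still carries the label of its column, and
that the column `e` of the label leaving the row to the east is occupied. Then the pipe `e` turns in
its own column and runs straight to the east. To the left of that column there is no turn either,
provided that it holds no `jElbow`. -/
theorem straight_row (D : BPD n) {i e : ℕ} (hi : i < n) (hen : e < n) (hw : D.wl i n = e)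
    (hs : ∀ j, j < n → (D.tile i j).south = true → D.sl i j = j)
    (he : (D.tile i e).south = true) :
    D.tile i e = .rElbow ∧ (∀ j, e < j → j ≤ n → D.HasWest i j ∧ D.wl i j = e) ∧
    ((∀ j, j < e → D.tile i j ≠ .jElbow) →
      ∀ j, j < e → D.tile i j = .vertical ∨ D.tile i j = .blank) := by
  have bound : ∀ j, j ≤ n → D.HasWest i j → D.wl i j < j := by
    intro j
    induction j with
    | zero => intro _ h; exact h.elim
    | succ j ih =>
      intro hj h
      have hwest := D.west_iff hi (j := j) (by omega)
      have h1 := hs j (by omega)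
      rw [wl_succ]
      cases ht : D.tile i j <;>
        simp [ht] at h hwest h1 ⊢ <;>
        grind
  have right : ∀ m j, j + m = n → e < j → D.HasWest i j ∧ D.wl i j = e := by
    intro m
    induction m with
    | zero =>
      intro j hj _
      obtain rfl : j = n := by omega
      exact ⟨D.hasWest_last hi, hw⟩
    | succ m ih =>
      intro j hj hej
      obtain ⟨h1, h2⟩ := ih (j + 1) (by omega) (by omega)
      have hwest := D.west_iff hi (j := j) (by omega)
      have h3 := hs j (by omega)
      rw [wl_succ] at h2
      cases ht : D.tile i j <;>
        simp [ht] at h1 h2 h3 hwest <;>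
        grind
  have mid : D.tile i e = .rElbow := by
    obtain ⟨h1, h2⟩ := right (n - (e + 1)) (e + 1) (by omega) (by omega)
    have hwest := D.west_iff hi hen
    have h3 := hs e hen he
    have h4 := bound e hen.le
    rw [wl_succ] at h2
    cases ht : D.tile i e <;>
      simp [ht] at h1 h2 h3 he hwest <;>
      grind
  refine ⟨mid, fun j h1 h2 => right (n - j) j (by omega) h1, fun hJ => ?_⟩
  have left : ∀ m j, j + m = e → ¬ D.HasWest i j := by
    intro m
    induction m with
    | zero =>
      intro j hj
      obtain rfl : j = e := by omega
      rw [← D.west_iff hi hen, mid]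
      simp [BTile.west]
    | succ m ih =>
      intro j hj
      have h1 := ih (j + 1) (by omega)
      have h2 := hJ j (by omega)
      rw [← D.west_iff hi (j := j) (by omega)]
      cases ht : D.tile i j <;> simp_all
  intro j hj
  have h1 := left (e - (j + 1)) (j + 1) (by omega)
  have h2 := hJ j hj
  cases ht : D.tile i j <;> simp_all

/-- The rows from `i₀` on agree with the Rothe bumpless pipe dream if each of them has no `jElbow` or
leads to a smaller label on the east border than all rows below it. In the second case a `jElbow`
in a column `j < p i` is impossible: no pipe enters it from below, so the label `j` leaves in a row
below. -/
theorem rothe_rows (D : BPD n) {p : Equiv.Perm ℕ} (hpn : ∀ i, i < n → p i < n)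
    (hqn : ∀ j, j < n → p.symm j < n) (hp : ∀ i, i < n → D.wl i n = p i) {i₀ : ℕ}
    (h : ∀ i, i₀ ≤ i → i < n →
      (∀ j, j < n → D.tile i j ≠ .jElbow) ∨ ∀ i', i < i' → i' < n → p i < p i')
    {i j : ℕ} (hi₀ : i₀ ≤ i) (hi : i < n) (hj : j < n) : D.tile i j = rotheTile p i j := by
  -- the structure of one row, in terms of the labels below it
  have row : ∀ i, i₀ ≤ i → i < n →
      (∀ j, j < n → (D.tile i j).south = decide (p.symm j ≤ i)) →
      (∀ j, j < n → (D.tile i j).south = true → D.sl i j = j) →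
      (∀ j, j < n → D.tile i j = rotheTile p i j) ∧
        ∀ j, j < n → (D.tile i j).north = true → D.nl i j = j := by
    intro i hi₀ hi hS hs
    obtain ⟨h1, h2, h3⟩ := D.straight_row hi (hpn i hi) (hp i hi) hs
      (by rw [hS _ (hpn i hi)]; simp)
    have h4 : ∀ j, j < p i → D.tile i j = .vertical ∨ D.tile i j = .blank := by
      refine h3 fun j hj hJ => ?_
      have hjn : j < n := hj.trans (hpn i hi)
      rcases h i hi₀ hi with h | h
      · exact h j hjn hJ
      · have h5 := hS j hjn
        rw [hJ] at h5
        simp only [BTile.south, Bool.false_eq, decide_eq_false_iff_not, not_le] at h5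
        have := h _ h5 (hqn j hjn)
        rw [Equiv.apply_symm_apply] at this
        omega
    have h5 : ∀ j, j < n → D.tile i j = rotheTile p i j := by
      intro j hj
      have hsj := hS j hj
      have hiff : p i = j ↔ p.symm j = i := by rw [Equiv.symm_apply_eq, eq_comm]
      unfold rotheTile
      rcases lt_trichotomy (p i) j with hij | rfl | hij
      · have e1 := (D.west_iff hi hj).mpr (h2 j hij hj.le).1
        have e2 : D.HasWest i (j + 1) := (h2 (j + 1) (by omega) (by omega)).1
        rw [if_neg (by omega), if_pos hij]
        cases ht : D.tile i j <;>
          simp [ht] at e1 e2 hsj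
        · rw [if_pos (by omega)]
        · rw [if_neg (by omega)]
      · rw [if_pos rfl, h1]
      · rw [if_neg (by omega), if_neg (by omega)]
        rcases h4 j hij with ht | ht <;> rw [ht] at hsj ⊢ <;> simp [BTile.south] at hsj
        · rw [if_pos (by omega)]
        · rw [if_neg (by omega)]
    refine ⟨h5, fun j hj hN => ?_⟩
    have hsj := hs j hj
    rw [nl]
    rcases lt_trichotomy (p i) j with hij | rfl | hij
    · have e1 := (D.west_iff hi hj).mpr (h2 j hij hj.le).1
      have e2 : D.HasWest i (j + 1) := (h2 (j + 1) (by omega) (by omega)).1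
      have e3 := (h2 j hij hj.le).2
      cases ht : D.tile i j <;>
        simp [ht] at e1 e2 hsj hN ⊢
      omega
    · rw [h1] at hN
      simp [BTile.north] at hN
    · rcases h4 j hij with ht | ht <;> rw [ht] at hN hsj ⊢ <;> simp at hN hsj ⊢; exact hsj
  have key : ∀ m i, i + m + 1 = n → i₀ ≤ i →
      (∀ j, j < n → (D.tile i j).south = decide (p.symm j ≤ i)) ∧
      (∀ j, j < n → (D.tile i j).south = true → D.sl i j = j) := by
    intro m
    induction m with
    | zero =>
      intro i hi _
      obtain rfl : i = n - 1 := by omega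
      refine ⟨fun j hj => ?_, fun j _ _ => D.sl_last j⟩
      have := hqn j hj
      rw [D.border_south j hj, eq_comm, decide_eq_true_iff]
      omega
    | succ m ih =>
      intro i hi hi₀
      obtain ⟨h1, h2⟩ := ih (i + 1) (by omega) (by omega)
      obtain ⟨h3, h4⟩ := row (i + 1) (by omega) (by omega) h1 h2
      refine ⟨fun j hj => ?_, fun j hj hS => ?_⟩
      · rw [D.match_vertical i j (by omega) hj, h3 j hj, rotheTile_north]
        simp
      · rw [D.match_vertical i j (by omega) hj] at hS
        rw [D.sl_eq_nl (by omega)]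
        exact h4 j hj hS
  obtain ⟨h1, h2⟩ := key (n - 1 - i) i (by omega) hi₀
  exact (row i hi₀ hi h1 h2).1 j hj

/-! ### The Rothe bumpless pipe dream -/

/-- The Rothe bumpless pipe dream of `π`. -/
def rothe (π : Equiv.Perm (Fin n)) : BPD n where
  tile i j := if i < n ∧ j < n then rotheTile (natPerm π) i j else .blank
  outside i j h := if_neg (by omega)
  match_horizontal i j hi hj := by
    rw [if_pos ⟨hi, by omega⟩, if_pos ⟨hi, hj⟩, rotheTile_east, rotheTile_west]
    simp
  match_vertical i j hi hj := by
    rw [if_pos ⟨by omega, hj⟩, if_pos ⟨hi, hj⟩, rotheTile_south, rotheTile_north]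
    simp
  border_west i hi := by
    rw [if_pos ⟨hi, by omega⟩, rotheTile_west]; simp
  border_north j hj := by
    rw [if_pos ⟨by omega, hj⟩, rotheTile_north]; simp
  border_east i hi := by
    have := natPerm_lt π hi
    rw [if_pos ⟨hi, by omega⟩, rotheTile_east, decide_eq_true_iff]; omega
  border_south j hj := by
    have := natPerm_symm_lt π hj
    rw [if_pos ⟨by omega, hj⟩, rotheTile_south, decide_eq_true_iff]; omega

theorem rothe_tile (π : Equiv.Perm (Fin n)) {i j : ℕ} (hi : i < n) (hj : j < n) :
    (rothe π).tile i j = rotheTile (natPerm π) i j := if_pos ⟨hi, hj⟩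

theorem rothe_isRothe (π : Equiv.Perm (Fin n)) : (rothe π).IsRothe π := by
  ext i j
  rw [toMatrix, Matrix.of_apply, Matrix.of_apply, rothe_tile π i.2 j.2, rotheTile, natPerm_val]
  simp only [Fin.val_inj]
  split_ifs <;> rfl

theorem IsRothe.eq_rothe {D : BPD n} {π : Equiv.Perm (Fin n)} (h : D.IsRothe π) : D = rothe π :=
  toMatrix_injective (h.trans (rothe_isRothe π).symm)

theorem rothe_hasPerm (π : Equiv.Perm (Fin n)) : (rothe π).HasPerm π := by
  rw [hasPerm_iff]
  -- the labels of one row, in terms of the labels below it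
  have row : ∀ i, i < n → (∀ j, j < n → (natPerm π).symm j ≤ i → (rothe π).sl i j = j) →
      ∀ j, natPerm π i < j → j ≤ n → (rothe π).wl i j = natPerm π i := by
    intro i hi hs j
    induction j with
    | zero => omega
    | succ j ih =>
      intro h1 h2
      rw [wl_succ, rothe_tile π hi (by omega), rotheTile]
      rcases Nat.lt_or_ge (natPerm π i) j with h | h
      · rw [if_neg (by omega), if_pos h]
        split_ifs with h3
        · simp only [hs j (by omega) h3.le, ih h (by omega)]
          omega
        · simp only [ih h (by omega)]
      · obtain rfl : natPerm π i = j := by omega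
        rw [if_pos rfl]
        exact hs _ (by omega) (by simp)
  have key : ∀ m i, i + m + 1 = n →
      ∀ j, j < n → (natPerm π).symm j ≤ i → (rothe π).sl i j = j := by
    intro m
    induction m with
    | zero =>
      intro i hi j _ _
      obtain rfl : i = n - 1 := by omega
      exact sl_last _ j
    | succ m ih =>
      intro i hi j hj hq
      have h1 := ih (i + 1) (by omega)
      have hne : natPerm π (i + 1) ≠ j := fun h => by
        rw [← h, Equiv.symm_apply_apply] at hq
        omega
      rw [sl_eq_nl _ (by omega), nl, rothe_tile π (by omega) hj, rotheTile, if_neg hne]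
      split_ifs with h2 h3 h3
      · simp only [h1 j hj (by omega), row (i + 1) (by omega) h1 j h2 hj.le]
        omega
      · omega
      · exact h1 j hj (by omega)
      · omega
  intro i hi
  exact row i hi (key (n - 1 - i) i (by omega)) n (natPerm_lt π hi) le_rfl

end BPD

/-! ### Droops -/

/-- `D'` arises from `D` by the simple droop in the square with north-west corner `(i, j)`. -/
def DroopAt {n : ℕ} (D D' : BPD n) (i j : ℕ) : Prop :=
  i + 1 < n ∧ j + 1 < n ∧
    D.tile i j = .rElbow ∧ D'.tile i j = .blank ∧
    D.tile (i + 1) (j + 1) = .blank ∧ D'.tile (i + 1) (j + 1) = .jElbow ∧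
    (D.tile (i + 1) j = .vertical ∧ D'.tile (i + 1) j = .rElbow ∨
      D.tile (i + 1) j = .jElbow ∧ D'.tile (i + 1) j = .horizontal) ∧
    (D.tile i (j + 1) = .horizontal ∧ D'.tile i (j + 1) = .rElbow ∨
      D.tile i (j + 1) = .jElbow ∧ D'.tile i (j + 1) = .vertical) ∧
    ∀ k l : ℕ, ¬ ((k = i ∨ k = i + 1) ∧ (l = j ∨ l = j + 1)) → D'.tile k l = D.tile k l

theorem simpleDroop_iff {n : ℕ} {D D' : BPD n} : SimpleDroop D D' ↔ ∃ i j, DroopAt D D' i j := Iff.rfl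

namespace BPD

variable {n : ℕ}

/-- Replace the four tiles of a `2 × 2` square by tiles that meet the border of the square in the
same edges and fit together inside it. -/
def setSquare (D : BPD n) (i j : ℕ) (hi : i + 1 < n) (hj : j + 1 < n) (a b c e : BTile)
    (ha : a.north = (D.tile i j).north ∧ a.west = (D.tile i j).west)
    (hb : b.north = (D.tile i (j + 1)).north ∧ b.east = (D.tile i (j + 1)).east)
    (hc : c.west = (D.tile (i + 1) j).west ∧ c.south = (D.tile (i + 1) j).south)
    (he : e.south = (D.tile (i + 1) (j + 1)).south ∧ e.east = (D.tile (i + 1) (j + 1)).east)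
    (hab : a.east = b.west) (hce : c.east = e.west) (hac : a.south = c.north)
    (hbe : b.south = e.north) : BPD n where
  tile k l :=
    if k = i then (if l = j then a else if l = j + 1 then b else D.tile k l)
    else if k = i + 1 then (if l = j then c else if l = j + 1 then e else D.tile k l)
    else D.tile k l
  outside k l h := by
    have := D.outside k l h
    grind
  match_horizontal k l hk hl := by
    have := D.match_horizontal k l hk hl
    grind
  match_vertical k l hk hl := by
    have := D.match_vertical k l hk hl
    grind
  border_west k hk := by
    have := D.border_west k hk
    grind
  border_north l hl := by
    have := D.border_north l hl
    grind
  border_east k hk := by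
    have := D.border_east k hk
    grind
  border_south l hl := by
    have := D.border_south l hl
    grind

theorem exists_droopAt (D : BPD n) {i j : ℕ} (hi : i + 1 < n) (hj : j + 1 < n)
    (h1 : D.tile i j = .rElbow) (h2 : D.tile (i + 1) (j + 1) = .blank)
    (h3 : D.tile (i + 1) j = .vertical ∨ D.tile (i + 1) j = .jElbow)
    (h4 : D.tile i (j + 1) = .horizontal ∨ D.tile i (j + 1) = .jElbow) :
    ∃ D', DroopAt D D' i j := by
  refine ⟨D.setSquare i j hi hj .blank
    (if D.tile i (j + 1) = .horizontal then .rElbow else .vertical)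
    (if D.tile (i + 1) j = .vertical then .rElbow else .horizontal) .jElbow ?_ ?_ ?_ ?_ ?_ ?_ ?_ ?_,
    hi, hj, h1, ?_, h2, ?_, ?_, ?_, ?_⟩
  pick_goal 13
  · intro k l hkl
    simp only [setSquare]
    grind
  all_goals
    rcases h3 with h3 | h3 <;> rcases h4 with h4 | h4 <;> simp [setSquare, h1, h2, h3, h4]

theorem exists_undroopAt (D : BPD n) {i j : ℕ} (hi : i + 1 < n) (hj : j + 1 < n)
    (h1 : D.tile i j = .blank) (h2 : D.tile (i + 1) (j + 1) = .jElbow)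
    (h3 : D.tile (i + 1) j = .rElbow ∨ D.tile (i + 1) j = .horizontal)
    (h4 : D.tile i (j + 1) = .rElbow ∨ D.tile i (j + 1) = .vertical) :
    ∃ D', DroopAt D' D i j := by
  refine ⟨D.setSquare i j hi hj .rElbow
    (if D.tile i (j + 1) = .rElbow then .horizontal else .jElbow)
    (if D.tile (i + 1) j = .rElbow then .vertical else .jElbow) .blank ?_ ?_ ?_ ?_ ?_ ?_ ?_ ?_,
    hi, hj, ?_, h1, ?_, h2, ?_, ?_, ?_⟩
  pick_goal 13
  · intro k l hkl
    simp only [setSquare]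
    grind
  all_goals
    rcases h3 with h3 | h3 <;> rcases h4 with h4 | h4 <;> simp [setSquare, h1, h2, h3, h4]

theorem wl_congr {D D' : BPD n} {k m₀ : ℕ} (h₀ : D'.wl k m₀ = D.wl k m₀) {m : ℕ} (hm : m₀ ≤ m)
    (h : ∀ l, m₀ ≤ l → l < m → D'.tile k l = D.tile k l ∧ D'.sl k l = D.sl k l) :
    D'.wl k m = D.wl k m := by
  induction m, hm using Nat.le_induction with
  | base => exact h₀
  | succ m hm ih =>
    obtain ⟨h1, h2⟩ := h m hm (by omega)
    rw [wl_succ, wl_succ, h1, h2, ih fun l h3 h4 => h l h3 (by omega)]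

theorem wl_congr_left {D D' : BPD n} {k m : ℕ}
    (h : ∀ l, l < m → D'.tile k l = D.tile k l ∧ D'.sl k l = D.sl k l) :
    D'.wl k m = D.wl k m :=
  wl_congr (m₀ := 0) (by rfl) (Nat.zero_le m) fun l _ => h l

theorem nl_congr {D D' : BPD n} {k l : ℕ} (h1 : D'.tile k l = D.tile k l)
    (h2 : D'.sl k l = D.sl k l) (h3 : D'.wl k l = D.wl k l) : D'.nl k l = D.nl k l := by
  rw [nl_def, nl_def, h1, h2, h3]

/-- Labels propagate upwards: if two bumpless pipe dreams agree in the rows from `k₁` to `k₀` and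
have the same labels below row `k₀`, then they have the same labels in these rows. -/
theorem sl_congr_up {D D' : BPD n} {k₀ : ℕ} (hk₀ : k₀ < n) (h₀ : ∀ l, l < n → D'.sl k₀ l = D.sl k₀ l)
    {m k : ℕ} (hk : k + m = k₀) (h : ∀ k', k < k' → k' ≤ k₀ → ∀ l, D'.tile k' l = D.tile k' l) :
    ∀ l, l < n → D'.sl k l = D.sl k l := by
  induction m generalizing k with
  | zero =>
    obtain rfl : k = k₀ := by omega
    exact h₀
  | succ m ih =>
    have h1 := ih (k := k + 1) (by omega) fun k' h2 h3 => h k' (by omega) h3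
    intro l hl
    rw [sl_eq_nl _ (by omega), sl_eq_nl _ (by omega)]
    refine nl_congr (h (k + 1) (by omega) (by omega) l) (h1 l hl)
      (wl_congr_left fun l' h2 =>
        ⟨h (k + 1) (by omega) (by omega) l', h1 l' (by omega)⟩)

end BPD

/-- A droop changes labels only inside its square, in particular none on the east border. -/
theorem DroopAt.wl_eq {n : ℕ} {D D' : BPD n} {i j : ℕ} (h : DroopAt D D' i j) {k : ℕ} (hk : k < n) :
    D'.wl k n = D.wl k n := by
  obtain ⟨hi, hj, h1, h2, h3, h4, h5, h6, h7⟩ := h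
  -- below the square
  have below : ∀ k, i + 1 ≤ k → k < n → ∀ l, l < n → D'.sl k l = D.sl k l := by
    intro k hik hk
    refine BPD.sl_congr_up (k₀ := n - 1) (m := n - 1 - k) (by omega) (fun l _ => ?_) (by omega) ?_
    · rw [BPD.sl_last, BPD.sl_last]
    · intro k' h8 _ l
      exact h7 k' l (by omega)
  -- the lower row of the square
  have b0 := below (i + 1) le_rfl hi
  have b1 : ∀ l, l ≤ j → D'.wl (i + 1) l = D.wl (i + 1) l := fun l hl =>
    BPD.wl_congr_left fun l' h8 =>
      ⟨h7 _ _ (by omega), b0 l' (by omega)⟩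
  have b2 : ∀ l, j + 2 ≤ l → l ≤ n → D'.wl (i + 1) l = D.wl (i + 1) l := by
    intro l hl hln
    refine BPD.wl_congr (m₀ := j + 2) ?_ hl fun l' h8 h9 => ⟨h7 _ _ (by omega), b0 l' (by omega)⟩
    rw [D'.wl_succ _ (j + 1), D.wl_succ _ (j + 1), h3, h4]
  have b3 : D'.nl (i + 1) (j + 1) = D.nl (i + 1) j := by
    rw [BPD.nl_def, BPD.nl_def, h4]
    simp only
    rw [BPD.wl_succ]
    rcases h5 with ⟨h5, h5'⟩ | ⟨h5, h5'⟩ <;> rw [h5, h5'] <;> simp only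
    · exact b0 j (by omega)
    · exact b1 j le_rfl
  -- the upper row of the square
  have c0 : ∀ l, l < n → l ≠ j → l ≠ j + 1 → D'.sl i l = D.sl i l := by
    intro l hl h8 h9
    rw [BPD.sl_eq_nl _ hi, BPD.sl_eq_nl _ hi]
    refine BPD.nl_congr (h7 _ _ (by omega)) (b0 l hl) ?_
    rcases Nat.lt_or_ge l j with h | h
    · exact b1 l h.le
    · exact b2 l (by omega) hl.le
  have c1 : ∀ l, l ≤ j → D'.wl i l = D.wl i l := fun l hl =>
    BPD.wl_congr_left fun l' h8 =>
      ⟨h7 _ _ (by omega), c0 l' (by omega) (by omega) (by omega)⟩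
  have c2 : D'.sl i (j + 1) = D.sl i j := by
    rw [BPD.sl_eq_nl _ hi, BPD.sl_eq_nl _ hi, b3]
  have c3 : D.wl i (j + 1) = D.sl i j := by rw [BPD.wl_succ, h1]
  have c4 : ∀ l, j + 2 ≤ l → l ≤ n → D'.wl i l = D.wl i l := by
    intro l hl hln
    refine BPD.wl_congr (m₀ := j + 2) ?_ hl fun l' h8 h9 =>
      ⟨h7 _ _ (by omega), c0 l' (by omega) (by omega) (by omega)⟩
    rw [D'.wl_succ _ (j + 1), D.wl_succ _ (j + 1)]
    rcases h6 with ⟨h6, h6'⟩ | ⟨h6, h6'⟩ <;> rw [h6, h6']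
    exact c2.trans c3.symm
  have c5 : ∀ l, l < n → D'.nl i l = D.nl i l := by
    intro l hl
    by_cases hl1 : l = j
    · subst hl1
      rw [BPD.nl_def, BPD.nl_def, h1, h2]
    by_cases hl2 : l = j + 1
    · subst hl2
      rw [BPD.nl_def, BPD.nl_def]
      rcases h6 with ⟨h6, h6'⟩ | ⟨h6, h6'⟩ <;> rw [h6, h6']
      exact c2.trans c3.symm
    refine BPD.nl_congr (h7 _ _ (by omega)) (c0 l hl hl1 hl2) ?_
    rcases Nat.lt_or_ge l j with h | h
    · exact c1 l h.le
    · exact c4 l (by omega) hl.le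
  rcases Nat.lt_or_ge (i + 1) k with h8 | h8
  · exact BPD.wl_congr_left fun l h9 =>
      ⟨h7 _ _ (by omega), below k (by omega) hk l h9⟩
  rcases Nat.lt_or_ge k i with h9 | h9
  · -- above the square
    have d0 : ∀ l, l < n → D'.sl (i - 1) l = D.sl (i - 1) l := by
      intro l hl
      have e := c5 l hl
      rw [BPD.sl_eq_nl _ (by omega), BPD.sl_eq_nl _ (by omega)]
      rwa [Nat.sub_add_cancel (by omega)]
    have d1 := BPD.sl_congr_up (D := D) (D' := D') (k₀ := i - 1) (m := i - 1 - k) (k := k)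
      (by omega) d0 (by omega) fun k' _ _ l => h7 _ _ (by omega)
    exact BPD.wl_congr_left fun l h10 =>
      ⟨h7 _ _ (by omega), d1 l h10⟩
  · rcases h8.eq_or_lt with rfl | h8
    · exact b2 n (by omega) le_rfl
    · obtain rfl : k = i := by omega
      exact c4 n (by omega) le_rfl

theorem SimpleDroop.hasPerm_iff {n : ℕ} {D D' : BPD n} (h : SimpleDroop D D')
    (π : Equiv.Perm (Fin n)) : D'.HasPerm π ↔ D.HasPerm π := by
  obtain ⟨i, j, h⟩ := simpleDroop_iff.mp h
  rw [BPD.hasPerm_iff, BPD.hasPerm_iff]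
  exact forall₂_congr fun k hk => by rw [h.wl_eq hk]

theorem DroopAt.blank_iff {n : ℕ} {D D' : BPD n} {i j : ℕ} (h : DroopAt D D' i j) {k l : ℕ} :
    D'.tile k l = .blank ↔
      (k = i ∧ l = j) ∨ (D.tile k l = .blank ∧ ¬ (k = i + 1 ∧ l = j + 1)) := by
  obtain ⟨-, -, h1, h2, h3, h4, h5, h6, h7⟩ := h
  by_cases hkl : (k = i ∨ k = i + 1) ∧ (l = j ∨ l = j + 1)
  · obtain ⟨rfl | rfl, rfl | rfl⟩ := hkl
    · simp [h2]
    · rcases h6 with h6 | h6 <;> simp [h6.1, h6.2]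
    · rcases h5 with h5 | h5 <;> simp [h5.1, h5.2]
    · simp [h4]
  · rw [h7 k l hkl]
    have ha : ¬ (k = i + 1 ∧ l = j + 1) := fun ⟨a, b⟩ => hkl ⟨Or.inr a, Or.inr b⟩
    have hb : ¬ (k = i ∧ l = j) := fun ⟨a, b⟩ => hkl ⟨Or.inl a, Or.inl b⟩
    simp [ha, hb]

namespace BPD

variable {n : ℕ}

/-- In a crossing-free region the tile diagonally to the north-west of a `jElbow` is blank or
a `jElbow`; in the first case the `jElbow` can be drooped back. -/
theorem exists_undroop_of_jElbow (D : BPD n) {a b : ℕ} (ha : a < n) (hb : b < n)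
    (hJ : D.tile a b = .jElbow) (hc : ∀ k l, k ≤ a → l < n → D.tile k l ≠ .cross) :
    ∃ D', SimpleDroop D' D := by
  induction a generalizing b with
  | zero => have := D.border_north b hb; simp [hJ] at this
  | succ a ih =>
    cases b with
    | zero => have := D.border_west (a + 1) ha; simp [hJ] at this
    | succ b =>
      have c1 := hc a b (by omega) (by omega)
      have c2 := hc a (b + 1) (by omega) hb
      have c3 := hc (a + 1) b le_rfl (by omega)
      have e1 := D.match_horizontal (a + 1) b ha hb
      have e2 := D.match_vertical a (b + 1) ha hb
      have e3 := D.match_horizontal a b (by omega) hb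
      have e4 := D.match_vertical a b ha (by omega)
      by_cases hJ' : D.tile a b = .jElbow
      · exact ih (by omega) (by omega) hJ' fun k l hk => hc k l (by omega)
      rw [hJ] at e1 e2
      have h3 : D.tile (a + 1) b = .rElbow ∨ D.tile (a + 1) b = .horizontal := by
        revert c3 e1; cases D.tile (a + 1) b <;> simp
      have h4 : D.tile a (b + 1) = .rElbow ∨ D.tile a (b + 1) = .vertical := by
        revert c2 e2; cases D.tile a (b + 1) <;> simp
      have h1 : D.tile a b = .blank := by
        have e3' : (D.tile a b).east = false := by
          rw [e3]; rcases h4 with h4 | h4 <;> simp [h4]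
        have e4' : (D.tile a b).south = false := by
          rw [e4]; rcases h3 with h3 | h3 <;> simp [h3]
        revert c1 hJ' e3' e4'; cases D.tile a b <;> simp
      obtain ⟨D', h⟩ := D.exists_undroopAt ha hb h1 hJ h3 h4
      exact ⟨D', a, b, h⟩

/-! ### Bumpless pipe dreams of a Grassmannian permutation -/

variable {π : Equiv.Perm (Fin n)} {d : ℕ}

theorem HasPerm.no_cross {D : BPD n} (h : D.HasPerm π) (hG : GrassAt (natPerm π) d) {i j : ℕ}
    (hid : i ≤ d) (hi : i < n) (hj : j < n) : D.tile i j ≠ .cross :=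
  D.no_cross_of_increasing ((hasPerm_iff D π).mp h) hG.top hid hi hj

theorem HasPerm.tile_eq_rotheTile {D : BPD n} (h : D.HasPerm π) (hG : GrassAt (natPerm π) d)
    {i j : ℕ} (hid : d < i) (hi : i < n) (hj : j < n) :
    D.tile i j = rotheTile (natPerm π) i j :=
  D.rothe_rows (fun _ => natPerm_lt π) (fun _ => natPerm_symm_lt π) ((hasPerm_iff D π).mp h)
    (i₀ := d + 1) (fun i hi _ => Or.inr fun i' hii _ => hG.bot i i' (by omega) hii) hid hi hj

theorem HasPerm.not_jElbow {D : BPD n} (h : D.HasPerm π) (hG : GrassAt (natPerm π) d) {i j : ℕ}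
    (hid : d < i) (hi : i < n) (hj : j < n) : D.tile i j ≠ .jElbow := by
  rw [h.tile_eq_rotheTile hG hid hi hj, rotheTile]
  split_ifs <;> simp

theorem HasPerm.not_blank {D : BPD n} (h : D.HasPerm π) (hG : GrassAt (natPerm π) d) {i j : ℕ}
    (hid : d < i) (hi : i < n) (hj : j < n) : D.tile i j ≠ .blank := by
  rw [h.tile_eq_rotheTile hG hid hi hj, rotheTile]
  have hiff : natPerm π i = j ↔ (natPerm π).symm j = i := by rw [Equiv.symm_apply_eq, eq_comm]
  split_ifs with h1 h2 h3 h4 <;> simp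
  have h5 := hG.bot i ((natPerm π).symm j) hid (by omega)
  rw [Equiv.apply_symm_apply] at h5
  omega

theorem mem_blanks {D : BPD n} {i j : ℕ} :
    (i, j) ∈ D.blanks ↔ (i < n ∧ j < n) ∧ D.tile i j = .blank := by
  simp [blanks]

theorem HasPerm.le_of_mem_blanks {D : BPD n} (h : D.HasPerm π) (hG : GrassAt (natPerm π) d)
    {i j : ℕ} (hij : (i, j) ∈ D.blanks) : i ≤ d := by
  obtain ⟨⟨hi, hj⟩, hb⟩ := mem_blanks.mp hij
  by_contra hid
  exact h.not_blank hG (not_le.mp hid) hi hj hb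

/-- A bumpless pipe dream of a Grassmannian permutation is determined by its blank tiles. -/
theorem HasPerm.ext_blanks {D D' : BPD n} (h : D.HasPerm π) (h' : D'.HasPerm π)
    (hG : GrassAt (natPerm π) d) (hb : ∀ i j, i ≤ d → ((i, j) ∈ D.blanks ↔ (i, j) ∈ D'.blanks)) :
    D = D' := by
  refine ext_of_scan fun i j hi hj hN hW => ?_
  rcases Nat.lt_or_ge d i with hid | hid
  · rw [h.tile_eq_rotheTile hG hid hi hj, h'.tile_eq_rotheTile hG hid hi hj]
  · have h1 := h.no_cross hG hid hi hj
    have h2 := h'.no_cross hG hid hi hj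
    have h3 := hb i j hid
    simp only [mem_blanks, hi, hj, and_self, true_and] at h3
    revert hN hW h1 h2 h3
    cases D.tile i j <;> cases D'.tile i j <;> simp

theorem HasPerm.eq_rothe {D : BPD n} (h : D.HasPerm π)
    (hJ : ∀ i j, i < n → j < n → D.tile i j ≠ .jElbow) : D = rothe π := by
  refine ext_of_scan fun i j hi hj _ _ => ?_
  rw [rothe_tile π hi hj]
  exact D.rothe_rows (fun _ => natPerm_lt π) (fun _ => natPerm_symm_lt π) ((hasPerm_iff D π).mp h)
    (i₀ := 0) (fun i _ hi => Or.inl fun j hj => hJ i j hi hj) (Nat.zero_le _) hi hj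

theorem sum_blanks_le (D : BPD n) : ∑ p ∈ D.blanks, p.1 ≤ n * n * n := by
  have h1 : D.blanks.card ≤ n * n := by
    refine (Finset.card_filter_le _ _).trans ?_
    simp
  have h2 : ∑ p ∈ D.blanks, p.1 ≤ D.blanks.card • n := by
    refine Finset.sum_le_card_nsmul _ _ _ fun p hp => ?_
    obtain ⟨⟨hi, -⟩, -⟩ := mem_blanks.mp (show (p.1, p.2) ∈ D.blanks from hp)
    exact hi.le
  exact h2.trans (by rw [smul_eq_mul]; exact Nat.mul_le_mul_right _ h1)

/-- The bumpless pipe dreams of a Grassmannian permutation are those obtained by simple droops from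
its Rothe bumpless pipe dream. -/
theorem hasPerm_iff_inDroop (hG : GrassAt (natPerm π) d) (D : BPD n) :
    D.HasPerm π ↔ InDroop π D := by
  constructor
  · intro h
    induction hm : n * n * n - ∑ p ∈ D.blanks, p.1 using Nat.strong_induction_on generalizing D with
    | _ m ih =>
      by_cases hJ : ∀ i j, i < n → j < n → D.tile i j ≠ .jElbow
      · obtain rfl := h.eq_rothe hJ
        exact ⟨_, rothe_isRothe π, .refl⟩
      · push Not at hJ
        obtain ⟨i, j, hi, hj, hJ⟩ := hJ
        have hid : i ≤ d := by
          by_contra hid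
          exact h.not_jElbow hG (not_le.mp hid) hi hj hJ
        obtain ⟨D', hD'⟩ := D.exists_undroop_of_jElbow hi hj hJ fun k l hk hl =>
          h.no_cross hG (hk.trans hid) (by omega) hl
        have h1 := hD'.rank_lt
        have h2 := D'.sum_blanks_le
        obtain ⟨R, hR, hRD⟩ := ih _ (by omega) D' ((hD'.hasPerm_iff π).mp h) rfl
        exact ⟨R, hR, hRD.tail hD'⟩
  · rintro ⟨R, hR, hRD⟩
    obtain rfl := hR.eq_rothe
    induction hRD with
    | refl => exact rothe_hasPerm π
    | tail _ h ih => exact (h.hasPerm_iff π).mpr ih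

end BPD

/-! ### Labels in a pipe dream -/

namespace PipeDream

variable {n : ℕ}

/-- The label on the west side of the tile `(i, j)`; for `j = n` this is the east border. -/
def side (D : PipeDream n) (i j : ℕ) : ℕ := D.sideLabel (D.northLabel i) i (n - j)

theorem side_last (D : PipeDream n) (i : ℕ) : D.side i n = 0 := by
  simp [side, sideLabel]

theorem side_eq (D : PipeDream n) (i : ℕ) {j : ℕ} (hj : j < n) :
    D.side i j = if (i, j) ∈ D.crosses then D.side i (j + 1) else D.northLabel i j := by
  have h1 : n - j = (n - (j + 1)) + 1 := by omega
  have h2 : n - 1 - (n - (j + 1)) = j := by omega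
  rw [side, h1, sideLabel, h2]
  rfl

theorem northLabel_succ (D : PipeDream n) (i j : ℕ) : D.northLabel (i + 1) j =
    if (i, j) ∈ D.crosses then D.northLabel i j else D.side i (j + 1) := by
  rw [northLabel, side, Nat.sub_sub, Nat.add_comm 1 j]

theorem pipesAt_eq (D : PipeDream n) (i j : ℕ) :
    D.pipesAt (i, j) = s(D.northLabel i j, D.side i (j + 1)) := by
  rw [pipesAt, side, Nat.sub_sub, Nat.add_comm 1 j]

theorem hasPerm_iff (D : PipeDream n) (π : Equiv.Perm (Fin n)) :
    D.HasPerm π ↔ ∀ i < n, D.side i 0 = natPerm π i := by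
  constructor
  · intro h i hi
    rw [natPerm_of_lt π hi]
    exact h ⟨i, hi⟩
  · intro h i
    rw [← natPerm_val]
    exact h i i.2

theorem isReduced_iff (D : PipeDream n) :
    D.IsReduced ↔ Set.InjOn D.pipesAt (D.crosses : Set (ℕ × ℕ)) := by
  constructor
  · intro h p hp q hq
    exact h p hp q hq
  · intro h p hp q hq
    exact h hp hq

theorem side_congr {D D' : PipeDream n} {k m₀ j : ℕ} (hm₀ : m₀ ≤ n)
    (h₀ : D'.side k m₀ = D.side k m₀) (hj : j ≤ m₀)
    (h : ∀ l, j ≤ l → l < m₀ →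
      ((k, l) ∈ D'.crosses ↔ (k, l) ∈ D.crosses) ∧ D'.northLabel k l = D.northLabel k l) :
    D'.side k j = D.side k j := by
  induction hj using Nat.decreasingInduction with
  | self => exact h₀
  | of_succ j hj ih =>
    obtain ⟨h1, h2⟩ := h j le_rfl hj
    rw [D'.side_eq _ (by omega), D.side_eq _ (by omega), ih fun l h3 => h l (by omega), h2]
    simp only [h1]

theorem side_congr_right {D D' : PipeDream n} {k j : ℕ} (hj : j ≤ n)
    (h : ∀ l, j ≤ l → l < n →
      ((k, l) ∈ D'.crosses ↔ (k, l) ∈ D.crosses) ∧ D'.northLabel k l = D.northLabel k l) :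
    D'.side k j = D.side k j :=
  side_congr le_rfl (by rw [side_last, side_last]) hj h

/-- If two pipe dreams agree in the rows from `k₀` on and have the same labels above row `k₀`, then
they have the same labels in these rows. -/
theorem northLabel_congr_down {D D' : PipeDream n} {k₀ k : ℕ} (hk : k₀ ≤ k)
    (h₀ : ∀ l, l < n → D'.northLabel k₀ l = D.northLabel k₀ l)
    (h : ∀ k', k₀ ≤ k' → k' < k → ∀ l, (k', l) ∈ D'.crosses ↔ (k', l) ∈ D.crosses) :
    ∀ l, l < n → D'.northLabel k l = D.northLabel k l := by
  induction k, hk using Nat.le_induction with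
  | base => exact h₀
  | succ k hk ih =>
    have h1 := ih fun k' h2 h3 => h k' h2 (by omega)
    intro l hl
    rw [northLabel_succ, northLabel_succ, h1 l hl,
      side_congr_right (D := D) (D' := D') (by omega) fun l' _ h4 =>
        ⟨h k hk (by omega) l', h1 l' h4⟩]
    simp only [h k hk (by omega)]

end PipeDream

/-! ### Slides -/

/-- `D'` arises from `D` by the simple slide in the square with north-west corner `(i, j)`. -/
def SlideAt {n : ℕ} (D D' : PipeDream n) (i j : ℕ) : Prop :=
  (i + 1, j) ∈ D.crosses ∧ (i, j) ∉ D.crosses ∧ (i, j + 1) ∉ D.crosses ∧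
    (i + 1, j + 1) ∉ D.crosses ∧ D'.crosses = insert (i, j + 1) (D.crosses.erase (i + 1, j))

theorem simpleSlide_iff {n : ℕ} {D D' : PipeDream n} :
    SimpleSlide D D' ↔ ∃ i j, SlideAt D D' i j := Iff.rfl

theorem SlideAt.mem_iff {n : ℕ} {D D' : PipeDream n} {i j : ℕ} (h : SlideAt D D' i j) {k l : ℕ} :
    (k, l) ∈ D'.crosses ↔ (k = i ∧ l = j + 1) ∨ ((k, l) ∈ D.crosses ∧ ¬ (k = i + 1 ∧ l = j)) := by
  rw [h.2.2.2.2]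
  simp only [Finset.mem_insert, Finset.mem_erase, Prod.mk.injEq, ne_eq]
  tauto

/-- A slide changes labels only inside its square, and it moves a crossing of two pipes. -/
theorem SlideAt.labels {n : ℕ} {D D' : PipeDream n} {i j : ℕ} (h : SlideAt D D' i j) :
    (∀ k, k < n → D'.side k 0 = D.side k 0) ∧
    D'.pipesAt (i, j + 1) = D.pipesAt (i + 1, j) ∧
    ∀ k l, (k, l) ∈ D.crosses → ¬ (k = i + 1 ∧ l = j) → D'.pipesAt (k, l) = D.pipesAt (k, l) := by
  have hmem : ∀ k l, (k, l) ∈ D'.crosses ↔ _ := fun k l => h.mem_iff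
  obtain ⟨h1, h2, h3, h4, -⟩ := h
  have hn := D.above _ h1
  simp only at hn
  have h1' : (i, j) ∉ D'.crosses := by rw [hmem]; simp [h2]
  have h2' : (i, j + 1) ∈ D'.crosses := by rw [hmem]; simp
  have h3' : (i + 1, j) ∉ D'.crosses := by rw [hmem]; simp
  have h4' : (i + 1, j + 1) ∉ D'.crosses := by rw [hmem]; simp [h4]
  have hout : ∀ k l, ¬ ((k = i ∨ k = i + 1) ∧ (l = j ∨ l = j + 1)) →
      ((k, l) ∈ D'.crosses ↔ (k, l) ∈ D.crosses) := by
    intro k l hkl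
    rw [hmem]
    constructor
    · rintro (h | h)
      · omega
      · exact h.1
    · intro h
      exact Or.inr ⟨h, by omega⟩
  -- above the square
  have a0 : ∀ k, k ≤ i → ∀ l, l < n → D'.northLabel k l = D.northLabel k l := fun k hk =>
    PipeDream.northLabel_congr_down (Nat.zero_le k) (fun _ _ => rfl)
      fun k' _ _ l => hout k' l (by omega)
  -- the upper row of the square
  have b1 : ∀ l, j + 2 ≤ l → l ≤ n → D'.side i l = D.side i l := fun l hl hln =>
    PipeDream.side_congr_right hln fun l' _ h6 => ⟨hout i l' (by omega), a0 i le_rfl l' h6⟩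
  have b2 : D'.side i j = D.side i j := by
    rw [D'.side_eq _ (by omega), D.side_eq _ (by omega), if_neg h1', if_neg h2,
      a0 i le_rfl j (by omega)]
  have b3 : ∀ l, l ≤ j → D'.side i l = D.side i l := fun l hl =>
    PipeDream.side_congr (by omega) b2 hl fun l' _ h6 =>
      ⟨hout i l' (by omega), a0 i le_rfl l' (by omega)⟩
  have b4 : ∀ l, l < n → l ≠ j → l ≠ j + 1 →
      D'.northLabel (i + 1) l = D.northLabel (i + 1) l := by
    intro l hl h5 h6
    rw [PipeDream.northLabel_succ, PipeDream.northLabel_succ, a0 i le_rfl l hl]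
    simp only [hout i l (by omega)]
    rcases Nat.lt_or_ge l j with h | h
    · rw [b3 (l + 1) h]
    · rw [b1 (l + 1) (by omega) hl]
  have b5 : D.northLabel (i + 1) j = D.northLabel i (j + 1) := by
    rw [PipeDream.northLabel_succ, if_neg h2, PipeDream.side_eq _ _ (by omega), if_neg h3]
  have b6 : D.northLabel (i + 1) (j + 1) = D.side i (j + 2) := by
    rw [PipeDream.northLabel_succ, if_neg h3]
  have b7 : D'.northLabel (i + 1) j = D.side i (j + 2) := by
    rw [PipeDream.northLabel_succ, if_neg h1', PipeDream.side_eq _ _ (by omega), if_pos h2',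
      b1 (j + 2) le_rfl (by omega)]
  have b8 : D'.northLabel (i + 1) (j + 1) = D.northLabel i (j + 1) := by
    rw [PipeDream.northLabel_succ, if_pos h2', a0 i le_rfl (j + 1) (by omega)]
  -- the lower row of the square
  have c1 : ∀ l, j + 2 ≤ l → l ≤ n → D'.side (i + 1) l = D.side (i + 1) l := fun l hl hln =>
    PipeDream.side_congr_right hln fun l' _ h6 =>
      ⟨hout (i + 1) l' (by omega), b4 l' h6 (by omega) (by omega)⟩
  have c2 : D.side (i + 1) (j + 1) = D.side i (j + 2) := by
    rw [PipeDream.side_eq _ _ (by omega), if_neg h4, b6]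
  have c3 : D'.side (i + 1) (j + 1) = D.northLabel i (j + 1) := by
    rw [PipeDream.side_eq _ _ (by omega), if_neg h4', b8]
  have c4 : D'.side (i + 1) j = D.side (i + 1) j := by
    rw [D'.side_eq _ (by omega), D.side_eq _ (by omega), if_neg h3', if_pos h1,
      b7, c2]
  have c5 : ∀ l, l ≤ j → D'.side (i + 1) l = D.side (i + 1) l := fun l hl =>
    PipeDream.side_congr (by omega) c4 hl fun l' _ h6 =>
      ⟨hout (i + 1) l' (by omega), b4 l' (by omega) (by omega) (by omega)⟩
  have c6 : ∀ l, l < n → D'.northLabel (i + 2) l = D.northLabel (i + 2) l := by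
    intro l hl
    rw [D'.northLabel_succ (i + 1), D.northLabel_succ (i + 1)]
    by_cases h5 : l = j
    · subst h5
      rw [if_neg h3', if_pos h1, c3, b5]
    by_cases h6 : l = j + 1
    · subst h6
      rw [if_neg h4', if_neg h4, c1 _ le_rfl (by omega)]
    rw [b4 l hl h5 h6]
    simp only [hout (i + 1) l (by omega)]
    rcases Nat.lt_or_ge l j with h | h
    · rw [c5 (l + 1) h]
    · rw [c1 (l + 1) (by omega) hl]
  -- below the square
  have e1 : ∀ k, i + 2 ≤ k → ∀ l, l < n → D'.northLabel k l = D.northLabel k l := fun k hk =>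
    PipeDream.northLabel_congr_down hk c6 fun k' _ _ l => hout k' l (by omega)
  have hN : ∀ k l, l < n → ¬ (k = i + 1 ∧ (l = j ∨ l = j + 1)) →
      D'.northLabel k l = D.northLabel k l := by
    intro k l hl hkl
    rcases Nat.lt_or_ge i k with h5 | h5
    · rcases (Nat.succ_le_of_lt h5).eq_or_lt with rfl | h5
      · exact b4 l hl (by omega) (by omega)
      · exact e1 k h5 l hl
    · exact a0 k h5 l hl
  have hS : ∀ k l, l ≤ n → ¬ ((k = i ∨ k = i + 1) ∧ l = j + 1) → D'.side k l = D.side k l := by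
    intro k l hl hkl
    by_cases h5 : k = i ∨ k = i + 1
    · rcases Nat.lt_or_ge j l with h6 | h6 <;> rcases h5 with rfl | rfl
      · exact b1 l (by omega) hl
      · exact c1 l (by omega) hl
      · exact b3 l h6
      · exact c5 l h6
    · exact PipeDream.side_congr_right hl fun l' _ h7 =>
        ⟨hout k l' (by omega), hN k l' h7 (by omega)⟩
  refine ⟨fun k _ => hS k 0 (Nat.zero_le n) (by omega), ?_, fun k l hkl hne => ?_⟩
  · rw [PipeDream.pipesAt_eq, PipeDream.pipesAt_eq, a0 i le_rfl (j + 1) (by omega),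
      b1 (j + 2) le_rfl (by omega), b5, c2]
  · have hln := D.above _ hkl
    simp only at hln
    rw [PipeDream.pipesAt_eq, PipeDream.pipesAt_eq, hN, hS]
    · omega
    · rintro ⟨rfl | rfl, h6⟩
      · obtain rfl : l = j := by omega
        exact h2 hkl
      · omega
    · omega
    · rintro ⟨rfl, rfl | rfl⟩
      · exact hne ⟨rfl, rfl⟩
      · exact h4 hkl

theorem SimpleSlide.hasPerm_iff {n : ℕ} {D D' : PipeDream n} (h : SimpleSlide D D')
    (π : Equiv.Perm (Fin n)) : D'.HasPerm π ↔ D.HasPerm π := by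
  obtain ⟨i, j, h⟩ := simpleSlide_iff.mp h
  rw [PipeDream.hasPerm_iff, PipeDream.hasPerm_iff]
  exact forall₂_congr fun k hk => by rw [h.labels.1 k hk]

theorem SimpleSlide.isReduced_iff {n : ℕ} {D D' : PipeDream n} (h : SimpleSlide D D') :
    D'.IsReduced ↔ D.IsReduced := by
  obtain ⟨i, j, h⟩ := simpleSlide_iff.mp h
  obtain ⟨-, h1, h2⟩ := h.labels
  obtain ⟨h3, -, h4, -, h5⟩ := h
  rw [PipeDream.isReduced_iff, PipeDream.isReduced_iff, h5]
  conv_rhs => rw [← Finset.insert_erase h3]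
  rw [Finset.coe_insert, Finset.coe_insert, Set.injOn_insert, Set.injOn_insert, h1]
  · have hE : Set.EqOn D'.pipesAt D.pipesAt (D.crosses.erase (i + 1, j) : Finset (ℕ × ℕ)) := by
      rintro ⟨k, l⟩ hkl
      have := Finset.mem_erase.mp (Finset.mem_coe.mp hkl)
      exact h2 k l this.2 fun h => this.1 (Prod.ext h.1 h.2)
    rw [hE.injOn_iff, hE.image_eq]
  · simp
  · exact fun h => h4 (Finset.mem_of_mem_erase (Finset.mem_coe.mp h))

/-! ### The word of a pipe dream -/

namespace PipeDream

variable {n : ℕ}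

/-- The cells in reading order: rows from top to bottom, each row from right to left. -/
def cell (n t : ℕ) : ℕ × ℕ := (t / n, n - 1 - t % n)

/-- The arrangement of the pipes after reading `t` cells. Along the staircase that separates the
cells already read from the others, position `a` holds the pipe `D.state t a`. A cross-tile `(i, j)`
exchanges the pipes in the positions `i + j` and `i + j + 1`, an elbow-tile changes nothing. -/
def state (D : PipeDream n) : ℕ → Equiv.Perm ℕ
  | 0 => 1
  | t + 1 => if cell n t ∈ D.crosses then
      D.state t * Equiv.swap ((cell n t).1 + (cell n t).2) ((cell n t).1 + (cell n t).2 + 1)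
    else D.state t

theorem cell_eq {i j : ℕ} (hj : j < n) : cell n (i * n + (n - 1 - j)) = (i, j) := by
  have h1 : (i * n + (n - 1 - j)) / n = i := by
    rw [Nat.add_comm, Nat.add_mul_div_right _ _ (by omega), Nat.div_eq_of_lt (by omega), zero_add]
  have h2 : (i * n + (n - 1 - j)) % n = n - 1 - j := by
    rw [Nat.add_comm, Nat.add_mul_mod_self_right, Nat.mod_eq_of_lt (by omega)]
  rw [cell, h1, h2]
  congr 1
  omega

theorem eq_of_cell {t i j : ℕ} (hn : 0 < n) (h : cell n t = (i, j)) :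
    j < n ∧ t = i * n + (n - 1 - j) := by
  simp only [cell, Prod.mk.injEq] at h
  have h1 := Nat.mod_lt t hn
  have h2 := Nat.div_add_mod' t n
  refine ⟨by omega, ?_⟩
  rw [← h.1, ← h.2]
  omega

theorem state_cell (D : PipeDream n) {i j : ℕ} (hj : j < n) :
    D.state (i * n + (n - j)) = if (i, j) ∈ D.crosses then
      D.state (i * n + (n - 1 - j)) * Equiv.swap (i + j) (i + j + 1)
    else D.state (i * n + (n - 1 - j)) := by
  have h : i * n + (n - j) = (i * n + (n - 1 - j)) + 1 := by omega
  rw [h, state, cell_eq hj]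

/-- Cells in columns from `j` on leave the positions before `i + j` alone. -/
theorem state_left (D : PipeDream n) {i j a : ℕ} (hj : j ≤ n) (ha : a < i + j) :
    D.state (i * n + (n - j)) a = D.state (i * n) a := by
  induction hj using Nat.decreasingInduction with
  | self => simp
  | of_succ j hj ih =>
    have h : n - (j + 1) = n - 1 - j := by omega
    rw [state_cell D hj, ← ih (by omega), h]
    split_ifs
    · rw [Equiv.Perm.mul_apply, Equiv.swap_apply_of_ne_of_ne (by omega) (by omega)]
    · rfl

/-- Cells in columns before `j` leave the positions after `i + j` alone. -/
theorem state_right (D : PipeDream n) {i j a : ℕ} (hj : j ≤ n) (ha : i + j < a) :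
    D.state ((i + 1) * n) a = D.state (i * n + (n - j)) a := by
  induction j with
  | zero => rw [Nat.sub_zero, Nat.succ_mul]
  | succ j ih =>
    have h : n - (j + 1) = n - 1 - j := by omega
    rw [ih (by omega) (by omega), state_cell D hj, h]
    split_ifs
    · rw [Equiv.Perm.mul_apply, Equiv.swap_apply_of_ne_of_ne (by omega) (by omega)]
    · rfl

theorem side_eq_state_of_northLabel (D : PipeDream n) {i : ℕ}
    (hN : ∀ j, i + j < n → D.northLabel i j = D.state (i * n) (i + j)) {j : ℕ} (hij : i + j < n) :
    D.side i j = D.state (i * n + (n - j)) (i + j) := by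
  induction hm : n - j generalizing j with
  | zero => omega
  | succ m ih =>
    have h : n - 1 - j = n - (j + 1) := by omega
    rw [side_eq _ _ (by omega), ← hm, state_cell D (by omega), h]
    split_ifs with hc
    · have h1 := D.above _ hc
      simp only at h1
      rw [ih (j := j + 1) (by omega) (by omega), Equiv.Perm.mul_apply, Equiv.swap_apply_left,
        ← Nat.add_assoc]
      congr 4
      omega
    · rw [hN j hij, state_left D (by omega) (by omega)]

theorem northLabel_eq_state (D : PipeDream n) {i j : ℕ} (hij : i + j < n) :
    D.northLabel i j = D.state (i * n) (i + j) := by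
  induction i generalizing j with
  | zero => simp [northLabel, state]
  | succ i ih =>
    have h : n - 1 - j = n - (j + 1) := by omega
    rw [northLabel_succ, state_right D (j := j) (by omega) (by omega), state_cell D (by omega), h]
    split_ifs with hc
    · rw [ih (by omega), Equiv.Perm.mul_apply, Nat.add_right_comm, Equiv.swap_apply_right,
        state_left D (by omega) (by omega)]
    · rw [side_eq_state_of_northLabel D (fun j => ih) (by omega)]
      congr 1
      omega

theorem side_eq_state (D : PipeDream n) {i j : ℕ} (hij : i + j < n) :
    D.side i j = D.state (i * n + (n - j)) (i + j) :=
  D.side_eq_state_of_northLabel (fun _ => D.northLabel_eq_state) hij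

theorem state_of_ge (D : PipeDream n) (t : ℕ) {a : ℕ} (ha : n ≤ a) : D.state t a = a := by
  induction t with
  | zero => rfl
  | succ t ih =>
    rw [state]
    split_ifs with hc
    · have h1 := D.above _ hc
      rw [Equiv.Perm.mul_apply, Equiv.swap_apply_of_ne_of_ne (by omega) (by omega), ih]
    · exact ih

/-- Position `i` is no longer touched after row `i`. -/
theorem state_row (D : PipeDream n) {i k : ℕ} (hk : i + 1 ≤ k) :
    D.state (k * n) i = D.state ((i + 1) * n) i := by
  induction k, hk using Nat.le_induction with
  | base => rfl
  | succ k hk ih =>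
    rw [← ih]
    have h := D.state_left (i := k) (j := 0) (a := i) (Nat.zero_le n) (by omega)
    rwa [Nat.sub_zero, ← Nat.succ_mul] at h

theorem HasPerm.state_eq {D : PipeDream n} {π : Equiv.Perm (Fin n)} (h : D.HasPerm π) :
    D.state (n * n) = natPerm π := by
  ext i
  rcases Nat.lt_or_ge i n with hi | hi
  · rw [D.state_row hi, ← (hasPerm_iff D π).mp h i hi, side_eq_state D (by omega), Nat.sub_zero,
      Nat.succ_mul, Nat.add_zero]
  · rw [state_of_ge _ _ hi, natPerm_of_ge π hi]

theorem pipesAt_eq_state (D : PipeDream n) {t i j : ℕ} (hc : (i, j) ∈ D.crosses)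
    (ht : cell n t = (i, j)) :
    D.northLabel i j = D.state t (i + j) ∧ D.side i (j + 1) = D.state t (i + j + 1) := by
  have h1 := D.above _ hc
  simp only at h1
  obtain ⟨hj, rfl⟩ := eq_of_cell (by omega) ht
  have h : n - 1 - j = n - (j + 1) := by omega
  rw [northLabel_eq_state D (by omega), side_eq_state D (by omega), h,
    state_left D (by omega) (by omega), ← Nat.add_assoc]
  exact ⟨rfl, rfl⟩

theorem swap_succ_lt {a u v : ℕ} (huv : u < v) (h : ¬ (u = a ∧ v = a + 1)) :
    Equiv.swap a (a + 1) u < Equiv.swap a (a + 1) v := by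
  simp only [Equiv.swap_apply_def]
  split_ifs <;> omega

/-- Two pipes whose order is reversed have crossed before. -/
theorem exists_cross_of_inversion (D : PipeDream n) {t a b : ℕ} (hab : a < b)
    (h : D.state t b < D.state t a) :
    ∃ t', t' < t ∧ cell n t' ∈ D.crosses ∧
      D.pipesAt (cell n t') = s(D.state t a, D.state t b) := by
  induction t generalizing a b with
  | zero =>
    simp only [state, Equiv.Perm.one_apply] at h
    omega
  | succ t ih =>
    rw [state] at h ⊢
    split_ifs at h ⊢ with hc
    · rcases hcell : cell n t with ⟨i, j⟩
      rw [hcell] at hc h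
      simp only [Equiv.Perm.mul_apply] at h ⊢
      by_cases hab' : a = i + j ∧ b = i + j + 1
      · obtain ⟨rfl, rfl⟩ := hab'
        obtain ⟨h1, h2⟩ := D.pipesAt_eq_state hc hcell
        refine ⟨t, by omega, by rwa [hcell], ?_⟩
        rw [hcell, pipesAt_eq, h1, h2, Equiv.swap_apply_left, Equiv.swap_apply_right, Sym2.eq_swap]
      · obtain ⟨t', h1, h2, h3⟩ := ih (swap_succ_lt hab hab') h
        exact ⟨t', by omega, h2, h3⟩
    · obtain ⟨t', h1, h2, h3⟩ := ih hab h
      exact ⟨t', by omega, h2, h3⟩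

/-- In a reduced pipe dream, every cross-tile produces an inversion of the permutation. -/
theorem IsReduced.inversion {D : PipeDream n} (hR : D.IsReduced) {π : Equiv.Perm (Fin n)}
    (hP : D.HasPerm π) {i j : ℕ} (hc : (i, j) ∈ D.crosses) :
    D.northLabel i j < D.side i (j + 1) ∧
      (natPerm π).symm (D.side i (j + 1)) < (natPerm π).symm (D.northLabel i j) := by
  have hn := D.above _ hc
  simp only at hn
  obtain ⟨t, ht, htn⟩ : ∃ t, cell n t = (i, j) ∧ t < n * n := by
    refine ⟨i * n + (n - 1 - j), cell_eq (by omega), ?_⟩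
    calc i * n + (n - 1 - j) < i * n + n := by omega
      _ = (i + 1) * n := by ring
      _ ≤ n * n := Nat.mul_le_mul_right n (by omega)
  obtain ⟨h1, h2⟩ := D.pipesAt_eq_state hc ht
  have hinj : ∀ t', cell n t' ∈ D.crosses → D.pipesAt (cell n t') = D.pipesAt (i, j) → t' = t := by
    intro t' h3 h4
    have h5 := hR _ h3 _ hc h4
    rw [(eq_of_cell (by omega) h5).2, (eq_of_cell (by omega) ht).2]
  constructor
  · by_contra hlt
    have hne : D.state t (i + j + 1) ≠ D.state t (i + j) := fun h => by
      have := (D.state t).injective h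
      omega
    rw [h1, h2] at hlt
    obtain ⟨t', h3, h4, h5⟩ := D.exists_cross_of_inversion (t := t) (Nat.lt_add_one (i + j))
      (by omega)
    rw [← h1, ← h2, ← pipesAt_eq] at h5
    have := hinj t' h4 h5
    omega
  · rw [h1, h2, ← hP.state_eq]
    have key : ∀ m, t + 1 ≤ m → (D.state m).symm (D.state t (i + j + 1)) <
        (D.state m).symm (D.state t (i + j)) := by
      intro m hm
      induction m, hm using Nat.le_induction with
      | base =>
        rw [state, ht, if_pos hc]
        simp [Equiv.Perm.mul_def]
      | succ m hm ih =>
        rw [state]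
        split_ifs with hc'
        · rcases hcell : cell n m with ⟨i', j'⟩
          rw [hcell] at hc'
          have e : ∀ x, (D.state m * Equiv.swap (i' + j') (i' + j' + 1)).symm x =
              Equiv.swap (i' + j') (i' + j' + 1) ((D.state m).symm x) := fun x => by
            simp [Equiv.Perm.mul_def]
          simp only [e]
          refine swap_succ_lt ih fun ⟨h3, h4⟩ => ?_
          obtain ⟨h5, h6⟩ := D.pipesAt_eq_state hc' hcell
          rw [← h3, Equiv.apply_symm_apply] at h5
          rw [← h4, Equiv.apply_symm_apply] at h6
          have h7 := hinj m (by rwa [hcell]) (by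
            rw [hcell, pipesAt_eq, pipesAt_eq, h5, h6, h1, h2, Sym2.eq_swap])
          omega
        · exact ih
    exact key _ htn

/-! ### Pipe dreams of a Grassmannian permutation -/

variable {π : Equiv.Perm (Fin n)} {d : ℕ}

/-- A cross with an elbow to its left can be slid back, possibly after moving down. Below such a
pair, two crosses would yield three pairwise inverted pipes, and a cross followed by an elbow would
make two pipes cross twice. -/
theorem IsReduced.exists_unslide {D : PipeDream n} (hR : D.IsReduced) (hP : D.HasPerm π)
    (hG : GrassAt (natPerm π) d) {i j : ℕ} (h1 : (i, j) ∉ D.crosses) (h2 : (i, j + 1) ∈ D.crosses) :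
    ∃ D', SimpleSlide D' D := by
  induction hm : n - i generalizing i with
  | zero =>
    have := D.above _ h2
    simp only at this
    omega
  | succ m ih =>
    have hn := D.above _ h2
    simp only at hn
    have e1 : D.northLabel (i + 1) (j + 1) = D.northLabel i (j + 1) := by
      rw [northLabel_succ, if_pos h2]
    have e2 : D.northLabel (i + 1) j = D.side i (j + 2) := by
      rw [northLabel_succ, if_neg h1, side_eq _ _ (by omega), if_pos h2]
    by_cases h3 : (i + 1, j) ∈ D.crosses <;> by_cases h4 : (i + 1, j + 1) ∈ D.crosses
    · exfalso
      have e3 : D.side (i + 1) (j + 1) = D.side (i + 1) (j + 2) := by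
        rw [side_eq _ _ (by omega), if_pos h4]
      obtain ⟨a1, a2⟩ := hR.inversion hP h2
      obtain ⟨b1, b2⟩ := hR.inversion hP h3
      rw [e2, e3] at b1 b2
      rw [show j + 1 + 1 = j + 2 from rfl] at a1 a2
      have key : ∀ x y, x < y → (natPerm π).symm y < (natPerm π).symm x →
          (natPerm π).symm y ≤ d ∧ d < (natPerm π).symm x := by
        intro x y hxy hs
        have t1 := hG.top _ _ hs
        have t2 := fun h => hG.bot _ _ h hs
        simp only [Equiv.apply_symm_apply] at t1 t2
        constructor
        · by_contra h
          have := t2 (by omega)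
          omega
        · by_contra h
          have := t1 (by omega)
          omega
      have k1 := key _ _ a1 a2
      have k2 := key _ _ b1 b2
      omega
    · exfalso
      have e3 : D.side (i + 1) (j + 1) = D.northLabel i (j + 1) := by
        rw [side_eq _ _ (by omega), if_neg h4, e1]
      have := hR _ h3 _ h2 (by rw [pipesAt_eq, pipesAt_eq, e2, e3, Sym2.eq_swap])
      simp at this
    · exact ih h3 h4 (by omega)
    · refine ⟨⟨insert (i + 1, j) (D.crosses.erase (i, j + 1)), ?_⟩, i, j, ?_⟩
      · intro p hp
        rcases Finset.mem_insert.mp hp with rfl | hp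
        · simp only
          omega
        · exact D.above p (Finset.mem_of_mem_erase hp)
      · refine ⟨by simp, by simp [h1], by simp, by simp [h4], ?_⟩
        rw [Finset.erase_insert (by simp [h3]), Finset.insert_erase h2]

/-- The pipe dreams in `slide(π)`, for a Grassmannian permutation, are the reduced pipe dreams
of `π`. -/
theorem inSlide_iff (hG : GrassAt (natPerm π) d) (D : PipeDream n) :
    InSlide π D ↔ D.IsReduced ∧ D.HasPerm π := by
  constructor
  · rintro ⟨B, hB, hBD⟩
    induction hBD with
    | refl => exact ⟨hB.1, hB.2.1⟩
    | tail _ h ih => exact ⟨h.isReduced_iff.mpr ih.1, (h.hasPerm_iff π).mpr ih.2⟩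
  · intro ⟨hR, hP⟩
    induction hm : ∑ p ∈ D.crosses, p.2 using Nat.strong_induction_on generalizing D with
    | _ m ih =>
      by_cases hL : ∀ i j : ℕ, (i, j + 1) ∈ D.crosses → (i, j) ∈ D.crosses
      · exact ⟨D, ⟨hR, hP, hL⟩, .refl⟩
      · push Not at hL
        obtain ⟨i, j, h1, h2⟩ := hL
        obtain ⟨D', hD'⟩ := hR.exists_unslide hP hG h2 h1
        have h3 := hD'.rank_lt
        obtain ⟨B, hB, hBD⟩ := ih _ (by omega) D' (hD'.isReduced_iff.mp hR)
          ((hD'.hasPerm_iff π).mp hP) rfl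
        exact ⟨B, hB, hBD.tail hD'⟩

end PipeDream

/-! ### Counting -/

/-- The cardinality of an initial segment of `range n`, given by a predicate. -/
theorem lt_card_filter_range {n : ℕ} {P : ℕ → Prop} [DecidablePred P]
    (hP : ∀ x y, x ≤ y → P y → P x) (x : ℕ) :
    x < ((Finset.range n).filter P).card ↔ x < n ∧ P x := by
  constructor
  · intro h
    by_contra hc
    have hsub : (Finset.range n).filter P ⊆ Finset.range x := by
      intro y hy
      rw [Finset.mem_filter, Finset.mem_range] at hy
      rw [Finset.mem_range]
      by_contra hyx
      exact hc ⟨by omega, hP x y (by omega) hy.2⟩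
    have := Finset.card_le_card hsub
    rw [Finset.card_range] at this
    omega
  · rintro ⟨h1, h2⟩
    have hsub : Finset.range (x + 1) ⊆ (Finset.range n).filter P := by
      intro y hy
      rw [Finset.mem_range] at hy
      rw [Finset.mem_filter, Finset.mem_range]
      exact ⟨by omega, hP y x (by omega) h2⟩
    have := Finset.card_le_card hsub
    rw [Finset.card_range] at this
    omega

/-- If any two elements of `A` are separated by an element of `B`, then `A` has at most one element
more than `B`. -/
theorem card_le_card_add_one_of_interlaced {A B : Finset ℕ}
    (h : ∀ a ∈ A, ∀ a' ∈ A, a < a' → ∃ b ∈ B, a ≤ b ∧ b < a') : A.card ≤ B.card + 1 := by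
  induction A using Finset.induction_on_max generalizing B with
  | empty => simp
  | insert x s hx ih =>
    have hxs : x ∉ s := fun hm => lt_irrefl _ (hx x hm)
    rw [Finset.card_insert_of_notMem hxs]
    rcases s.eq_empty_or_nonempty with rfl | hs
    · simp
    · have hmax := s.max'_mem hs
      obtain ⟨b, hb, h1, h2⟩ := h _ (Finset.mem_insert_of_mem hmax) x (Finset.mem_insert_self _ _)
        (hx _ hmax)
      have h3 := ih (B := B.erase b) fun a ha a' ha' haa => by
        obtain ⟨b', hb', h4, h5⟩ := h a (Finset.mem_insert_of_mem ha) a'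
          (Finset.mem_insert_of_mem ha') haa
        have := s.le_max' a' ha'
        exact ⟨b', Finset.mem_erase.mpr ⟨by omega, hb'⟩, h4, h5⟩
      rw [Finset.card_erase_of_mem hb] at h3
      have := Finset.card_pos.mpr ⟨b, hb⟩
      omega

/-! ### Totally symmetric self-complementary plane partitions and their lattice paths -/

namespace TSSCPP

variable {n : ℕ}

theorem entry_symm (T : TSSCPP n) (i j : ℕ) : T.1.entry i j = T.1.entry j i := T.2.2.1 i j

theorem rotate (T : TSSCPP n) {i j k : ℕ} : k < T.1.entry i j ↔ i < T.1.entry j k := by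
  have h := T.2.2.2.1
  exact ⟨h i j k, fun h1 => h k i j (h j k i h1)⟩

theorem swap_right (T : TSSCPP n) {i j k : ℕ} : k < T.1.entry i j ↔ j < T.1.entry i k := by
  rw [T.rotate, T.rotate, T.entry_symm]

theorem lt_of_mem (T : TSSCPP n) {i j k : ℕ} (h : k < T.1.entry i j) :
    i < 2 * n ∧ j < 2 * n ∧ k < 2 * n := by
  obtain ⟨h1, h2⟩ := T.2.1
  have h3 := h2 i j
  have h4 := h1 i j
  omega

theorem complement (T : TSSCPP n) {i j k : ℕ} (hi : i < 2 * n) (hj : j < 2 * n) (hk : k < 2 * n) :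
    k < T.1.entry i j ↔
      ¬ 2 * n - 1 - k < T.1.entry (2 * n - 1 - i) (2 * n - 1 - j) := by
  have h1 := T.2.2.2.2 i j hi hj
  have h2 := T.2.1.2 (2 * n - 1 - i) (2 * n - 1 - j)
  omega

/-- The points of the fundamental domain lie in a staircase. -/
theorem bound (T : TSSCPP n) {a b k : ℕ} (h : k < T.1.entry (n + a) (n + b)) : k + b + 1 < n := by
  obtain ⟨h1, h2, h3⟩ := T.lt_of_mem h
  by_contra hc
  refine (T.complement h1 h2 h3).mp h ?_
  have h4 := T.swap_right.mp h
  have h5 := T.1.anti (2 * n - 1 - (n + a)) (2 * n - 1 - (n + b)) (n + a) k (by omega) (by omega)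
  omega

theorem lt_levelCount (T : TSSCPP n) {L : ℕ} (hL : L ≠ 0) {δ x : ℕ} :
    x < T.levelCount L δ ↔ L ≤ T.1.entry (n + x) (n + x + δ) := by
  rw [levelCount, lt_card_filter_range]
  · refine ⟨And.right, fun h => ⟨?_, h⟩⟩
    have := T.lt_of_mem (i := n + x) (j := n + x + δ) (k := 0) (by omega)
    omega
  · intro y z hyz hz
    exact hz.trans (T.1.anti _ _ _ _ (by omega) (by omega))

/-- A lattice path goes down by at most one row between consecutive diagonals. -/
theorem levelCount_succ (T : TSSCPP n) {L : ℕ} (hL : L ≠ 0) (δ : ℕ) :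
    T.levelCount L (δ + 1) ≤ T.levelCount L δ ∧ T.levelCount L δ ≤ T.levelCount L (δ + 1) + 1 := by
  constructor
  · by_contra h
    have h1 := (T.lt_levelCount hL).mp (not_le.mp h)
    have h2 := T.1.anti (n + T.levelCount L δ) (n + T.levelCount L δ + δ)
      (n + T.levelCount L δ) (n + T.levelCount L δ + (δ + 1)) le_rfl (by omega)
    have h3 := (T.lt_levelCount (δ := δ) hL).mpr (h1.trans h2)
    omega
  · by_contra h
    have h1 := (T.lt_levelCount hL).mp (not_le.mp h)
    have h2 := T.1.anti (n + T.levelCount L (δ + 1)) (n + T.levelCount L (δ + 1) + (δ + 1))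
      (n + (T.levelCount L (δ + 1) + 1)) (n + (T.levelCount L (δ + 1) + 1) + δ)
      (by omega) (by omega)
    have h3 := (T.lt_levelCount (δ := δ + 1) hL).mpr (h1.trans h2)
    omega

theorem levelCount_eq_zero (T : TSSCPP n) {L δ : ℕ} (hL : L ≠ 0) (h : n ≤ L + δ) :
    T.levelCount L δ = 0 := by
  by_contra h0
  have h1 := (T.lt_levelCount (x := 0) (δ := δ) hL).mp (by omega)
  have h2 := T.bound (a := 0) (b := δ) (k := L - 1) (by simp only [Nat.add_zero] at h1 ⊢; omega)
  omega

theorem mem_toPipeDream (T : TSSCPP n) {r c : ℕ} :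
    (r, c) ∈ T.toPipeDream.crosses ↔ r + c + 1 < n ∧
      T.levelCount (n - 1 - (r + c)) r = T.levelCount (n - 1 - (r + c)) (r + 1) := by
  have h : T.toPipeDream.crosses = (Finset.range n ×ˢ Finset.range n).filter fun p =>
    p.1 + p.2 + 1 < n ∧ T.boolTriangle (n - (p.1 + 1)) ((p.1 + 1) + (p.2 + 1) - 1) = 1 := rfl
  rw [h, Finset.mem_filter, Finset.mem_product, Finset.mem_range, Finset.mem_range]
  simp only [boolTriangle]
  constructor
  · rintro ⟨-, h1, h2⟩
    refine ⟨h1, ?_⟩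
    have e1 : n - (r + 1 + (c + 1) - 1) = n - 1 - (r + c) := by omega
    have e2 : n - (n - (r + 1)) - 1 = r := by omega
    have e3 : n - (n - (r + 1)) = r + 1 := by omega
    rw [e1, e2, e3] at h2
    by_contra hne
    rw [if_neg hne] at h2
    omega
  · rintro ⟨h1, h2⟩
    refine ⟨by omega, h1, ?_⟩
    have e1 : n - (r + 1 + (c + 1) - 1) = n - 1 - (r + c) := by omega
    have e2 : n - (n - (r + 1)) - 1 = r := by omega
    have e3 : n - (n - (r + 1)) = r + 1 := by omega
    rw [e1, e2, e3, if_pos h2]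

/-- The pipe dream determines the lattice paths, these determine the fundamental domain, and the
symmetries carry the fundamental domain to the whole box. -/
theorem toPipeDream_injective : Function.Injective (toPipeDream : TSSCPP n → PipeDream n) := by
  intro T T' h
  have hmem : ∀ r c, (r, c) ∈ T.toPipeDream.crosses ↔ (r, c) ∈ T'.toPipeDream.crosses := by
    intro r c; rw [h]
  have level : ∀ L, L ≠ 0 → ∀ m δ, n ≤ δ + m → T.levelCount L δ = T'.levelCount L δ := by
    intro L hL m
    induction m with
    | zero =>
      intro δ hδ
      rw [T.levelCount_eq_zero hL (by omega), T'.levelCount_eq_zero hL (by omega)]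
    | succ m ih =>
      intro δ hδ
      have h1 := ih (δ + 1) (by omega)
      rcases Nat.lt_or_ge (L + δ) n with h2 | h2
      · have h3 := hmem δ (n - 1 - L - δ)
        rw [mem_toPipeDream, mem_toPipeDream] at h3
        have e1 : n - 1 - (δ + (n - 1 - L - δ)) = L := by omega
        rw [e1] at h3
        have h4 := T.levelCount_succ hL δ
        have h5 := T'.levelCount_succ hL δ
        omega
      · rw [T.levelCount_eq_zero hL h2, T'.levelCount_eq_zero hL h2]
  have fund : ∀ a δ k, k < T.1.entry (n + a) (n + a + δ) ↔ k < T'.1.entry (n + a) (n + a + δ) := by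
    intro a δ k
    have h1 := T.lt_levelCount (L := k + 1) (by omega) (δ := δ) (x := a)
    have h2 := T'.lt_levelCount (L := k + 1) (by omega) (δ := δ) (x := a)
    rw [level (k + 1) (by omega) n δ (by omega)] at h1
    exact h1.symm.trans h2
  have corner : ∀ i j k, n ≤ i → n ≤ j → (k < T.1.entry i j ↔ k < T'.1.entry i j) := by
    intro i j k hi hj
    rcases le_total i j with hij | hij
    · have := fund (i - n) (j - i) k
      rwa [Nat.add_sub_cancel' hi, Nat.add_sub_cancel' hij] at this
    · have := fund (j - n) (i - j) k
      rw [Nat.add_sub_cancel' hj, Nat.add_sub_cancel' hij] at this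
      rwa [T.entry_symm, T'.entry_symm]
  have two : ∀ i j k, (n ≤ i ∧ n ≤ j) ∨ (n ≤ j ∧ n ≤ k) ∨ (n ≤ i ∧ n ≤ k) →
      (k < T.1.entry i j ↔ k < T'.1.entry i j) := by
    rintro i j k (h1 | h1 | h1)
    · exact corner i j k h1.1 h1.2
    · rw [T.rotate, T'.rotate]
      exact corner j k i h1.1 h1.2
    · rw [T.swap_right, T'.swap_right]
      exact corner i k j h1.1 h1.2
  have all : ∀ i j k, k < T.1.entry i j ↔ k < T'.1.entry i j := by
    intro i j k
    by_cases hb : i < 2 * n ∧ j < 2 * n ∧ k < 2 * n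
    · obtain ⟨hi, hj, hk⟩ := hb
      by_cases h2 : (n ≤ i ∧ n ≤ j) ∨ (n ≤ j ∧ n ≤ k) ∨ (n ≤ i ∧ n ≤ k)
      · exact two i j k h2
      · rw [T.complement hi hj hk, T'.complement hi hj hk]
        exact not_congr (two _ _ _ (by omega))
    · exact ⟨fun h => absurd (T.lt_of_mem h) hb, fun h => absurd (T'.lt_of_mem h) hb⟩
  refine Subtype.ext (PlanePartition.ext ?_)
  funext i j
  have h1 := all i j (T.1.entry i j)
  have h2 := all i j (T'.1.entry i j)
  omega

/-! ### Plane partitions from a fundamental domain -/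

/-- The data of a fundamental domain: `V a b k` says that the point `(n + a, n + b, k)` belongs to
the plane partition. -/
structure IsFundamental (n : ℕ) (V : ℕ → ℕ → ℕ → Prop) : Prop where
  symm : ∀ a b k, V a b k → V b a k
  anti : ∀ a b k a' b' k', a' ≤ a → b' ≤ b → k' ≤ k → V a b k → V a' b' k'
  bound : ∀ a b k, V a b k → k + b + 1 < n

/-- The points of the plane partition with fundamental domain `V`. A point of the box with at least
two coordinates `≥ n` is carried into the fundamental domain by a permutation of the coordinates;
any other point has a complementary point of this kind. -/
def BoxMem (n : ℕ) (V : ℕ → ℕ → ℕ → Prop) (i j k : ℕ) : Prop :=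
  i < 2 * n ∧ j < 2 * n ∧ k < 2 * n ∧
    if n ≤ i then
      if n ≤ j then
        if n ≤ k then False else V (i - n) (j - n) k
      else
        if n ≤ k then V (i - n) (k - n) j else ¬ V (n - 1 - j) (n - 1 - k) (2 * n - 1 - i)
    else
      if n ≤ j then
        if n ≤ k then V (j - n) (k - n) i else ¬ V (n - 1 - i) (n - 1 - k) (2 * n - 1 - j)
      else
        if n ≤ k then ¬ V (n - 1 - i) (n - 1 - j) (2 * n - 1 - k) else True

variable {V : ℕ → ℕ → ℕ → Prop}

theorem BoxMem.swap_left (hV : IsFundamental n V) {i j k : ℕ} (h : BoxMem n V i j k) :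
    BoxMem n V j i k := by
  have hs : ∀ a b k, V a b k ↔ V b a k := fun a b k => ⟨hV.symm a b k, hV.symm b a k⟩
  obtain ⟨hi, hj, hk, h⟩ := h
  refine ⟨hj, hi, hk, ?_⟩
  split_ifs at h ⊢ <;> first | trivial | exact h | exact (hs _ _ _).mp h | exact mt (hs _ _ _).mp h

theorem BoxMem.swap_right (hV : IsFundamental n V) {i j k : ℕ} (h : BoxMem n V i j k) :
    BoxMem n V i k j := by
  have hs : ∀ a b k, V a b k ↔ V b a k := fun a b k => ⟨hV.symm a b k, hV.symm b a k⟩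
  obtain ⟨hi, hj, hk, h⟩ := h
  refine ⟨hi, hk, hj, ?_⟩
  split_ifs at h ⊢ <;> first | trivial | exact h | exact (hs _ _ _).mp h | exact mt (hs _ _ _).mp h

theorem BoxMem.anti_right (hV : IsFundamental n V) {i j k k' : ℕ} (hk' : k' ≤ k)
    (h : BoxMem n V i j k) : BoxMem n V i j k' := by
  obtain ⟨hi, hj, hk, h⟩ := h
  refine ⟨hi, hj, by omega, ?_⟩
  have ha := hV.anti
  have hb := hV.bound
  have hs := hV.symm
  split_ifs at h ⊢ <;> first | trivial | omega | skip
  · exact ha _ _ _ _ _ _ le_rfl le_rfl hk' h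
  · exact ha _ _ _ _ _ _ le_rfl (by omega) le_rfl h
  -- the staircase condition excludes that `V` holds at a point and at this complementary point
  · intro h'
    have h1 := hb _ _ _ (hs _ _ _ h')
    have h2 := hb _ _ _ (hs _ _ _ h)
    omega
  · exact fun h' => h (ha _ _ _ _ _ _ le_rfl (by omega) le_rfl h')
  · exact ha _ _ _ _ _ _ le_rfl (by omega) le_rfl h
  · intro h'
    have h1 := hb _ _ _ (hs _ _ _ h')
    have h2 := hb _ _ _ (hs _ _ _ h)
    omega
  · exact fun h' => h (ha _ _ _ _ _ _ le_rfl (by omega) le_rfl h')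
  · exact fun h' => h (ha _ _ _ _ _ _ le_rfl le_rfl (by omega) h')

theorem BoxMem.anti (hV : IsFundamental n V) {i j k i' j' k' : ℕ} (hi : i' ≤ i) (hj : j' ≤ j)
    (hk : k' ≤ k) (h : BoxMem n V i j k) : BoxMem n V i' j' k' :=
  (((h.anti_right hV hk).swap_right hV |>.anti_right hV hj).swap_left hV |>.swap_right hV
    |>.anti_right hV hi).swap_right hV |>.swap_left hV |>.swap_right hV

theorem boxMem_complement {i j k : ℕ} (hi : i < 2 * n) (hj : j < 2 * n)
    (hk : k < 2 * n) :
    BoxMem n V i j k ↔ ¬ BoxMem n V (2 * n - 1 - i) (2 * n - 1 - j) (2 * n - 1 - k) := by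
  have hr : ∀ x, x < 2 * n → 2 * n - 1 - x < 2 * n ∧ (n ≤ 2 * n - 1 - x ↔ ¬ n ≤ x) ∧
      2 * n - 1 - (2 * n - 1 - x) = x ∧ n - 1 - (2 * n - 1 - x) = x - n ∧
      2 * n - 1 - x - n = n - 1 - x := by omega
  obtain ⟨i1, i2, i3, i4, i5⟩ := hr i hi
  obtain ⟨j1, j2, j3, j4, j5⟩ := hr j hj
  obtain ⟨k1, k2, k3, k4, k5⟩ := hr k hk
  simp only [BoxMem, hi, hj, hk, i1, i2, i3, i4, i5, j1, j2, j3, j4, j5, k1, k2, k3, k4, k5,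
    true_and]
  split_ifs <;> tauto

/-- The plane partition with fundamental domain `V`. -/
noncomputable def ofFundamental (hV : IsFundamental n V) : TSSCPP n := by
  classical
  exact
  let e (i j : ℕ) : ℕ := ((Finset.range (2 * n)).filter fun k => BoxMem n V i j k).card
  have he (i j k : ℕ) : k < e i j ↔ BoxMem n V i j k := by
    rw [lt_card_filter_range fun x y hxy hy => hy.anti hV le_rfl le_rfl hxy]
    exact and_iff_right_of_imp fun h => h.2.2.1
  have hle (i j : ℕ) : e i j ≤ 2 * n := by
    by_contra h
    have := ((he i j _).mp (not_le.mp h)).2.2.1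
    omega
  ⟨⟨e, fun i j i' j' hi hj => by
      by_contra h
      have := (he i j (e i j)).mpr (((he _ _ _).mp (not_le.mp h)).anti hV hi hj le_rfl)
      omega⟩,
    ⟨fun i j hij => by
      by_contra h
      have h1 := (he i j 0).mp (Nat.pos_of_ne_zero h)
      have h2 := h1.1
      have h3 := h1.2.1
      omega, hle⟩,
    fun i j => by
      have h1 := (he i j (e j i)).trans ⟨fun h => h.swap_left hV, fun h => h.swap_left hV⟩
      have h2 := (he j i (e i j)).trans ⟨fun h => h.swap_left hV, fun h => h.swap_left hV⟩
      rw [← he] at h1 h2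
      show e i j = e j i
      omega,
    fun i j k h => (he _ _ _).mpr ((((he _ _ _).mp h).swap_left hV).swap_right hV),
    fun i j hi hj => by
      show e i j = 2 * n - e (2 * n - 1 - i) (2 * n - 1 - j)
      have hc : ∀ k, k < 2 * n → (k < e i j ↔
          ¬ 2 * n - 1 - k < e (2 * n - 1 - i) (2 * n - 1 - j)) := fun k hk => by
        rw [he, he]
        exact boxMem_complement hi hj hk
      have h1 := hc (e i j)
      have h2 := hc (2 * n - e (2 * n - 1 - i) (2 * n - 1 - j))
      have h3 := hle i j
      have h4 := hle (2 * n - 1 - i) (2 * n - 1 - j)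
      omega⟩

theorem lt_ofFundamental (hV : IsFundamental n V) {i j k : ℕ} :
    k < (ofFundamental hV).1.entry i j ↔ BoxMem n V i j k := by
  classical
  have : (ofFundamental hV).1.entry i j =
    ((Finset.range (2 * n)).filter fun k => BoxMem n V i j k).card := rfl
  rw [this, lt_card_filter_range fun x y hxy hy => hy.anti hV le_rfl le_rfl hxy]
  exact and_iff_right_of_imp fun h => h.2.2.1

end TSSCPP

/-! ### Pipe dreams that come from plane partitions -/

namespace PipeDream

variable {n : ℕ}

/-- Any two crosses on an antidiagonal are separated by a cross on the preceding antidiagonal. -/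
def Interlaced (D : PipeDream n) : Prop :=
  ∀ m r r', r < r' → r' ≤ m + 1 → (r, m + 1 - r) ∈ D.crosses → (r', m + 1 - r') ∈ D.crosses →
    ∃ s, r ≤ s ∧ s < r' ∧ (s, m - s) ∈ D.crosses

theorem IsBottom.interlaced {D : PipeDream n} {π : Equiv.Perm (Fin n)} (h : D.IsBottom π) :
    D.Interlaced := by
  intro m r r' hr hr' h1 _
  refine ⟨r, le_rfl, hr, h.2.2 _ _ ?_⟩
  rwa [show m - r + 1 = m + 1 - r by omega]

theorem _root_.PipeASM.SlideAt.interlaced {D D' : PipeDream n} {i j : ℕ} (h : SlideAt D D' i j)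
    (hD : D.Interlaced) : D'.Interlaced := by
  have hmem : ∀ k l, (k, l) ∈ D'.crosses ↔ _ := fun k l => h.mem_iff
  obtain ⟨h1, h2, h3, h4, -⟩ := h
  intro m r r' hr hr' hc hc'
  rw [hmem] at hc hc'
  -- the position of a cross before the slide
  have old : ∀ r, r ≤ m + 1 → (r = i ∧ m + 1 - r = j + 1 ∨
      (r, m + 1 - r) ∈ D.crosses ∧ ¬(r = i + 1 ∧ m + 1 - r = j)) →
      (if m = i + j ∧ r = i then i + 1 else r) ≤ m + 1 ∧
      ((if m = i + j ∧ r = i then i + 1 else r),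
        m + 1 - (if m = i + j ∧ r = i then i + 1 else r)) ∈ D.crosses := by
    intro r hr hc
    split_ifs with hm
    · obtain ⟨rfl, rfl⟩ := hm
      refine ⟨by omega, ?_⟩
      rwa [show r + j + 1 - (r + 1) = j by omega]
    · refine ⟨hr, ?_⟩
      rcases hc with hc | hc
      · omega
      · exact hc.1
  obtain ⟨a1, a2⟩ := old r (by omega) hc
  obtain ⟨b1, b2⟩ := old r' hr' hc'
  obtain ⟨s, s1, s2, s3⟩ := hD m _ _ (by split_ifs <;> omega) b1 a2 b2
  by_cases hs : s = i + 1 ∧ m - s = j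
  · refine ⟨i, ?_, ?_, ?_⟩
    · by_contra hri
      have : r = i + 1 ∧ m + 1 - r = j + 1 := by split_ifs at s1 s2 <;> omega
      rw [this.1] at hc
      rw [this.1] at this
      rw [this.2] at hc
      exact h4 (by rcases hc with hc | hc; · omega
                   · exact hc.1)
    · split_ifs at s1 s2 <;> omega
    · rw [hmem]
      left
      omega
  · refine ⟨s, ?_, ?_, ?_⟩
    · split_ifs at s1 <;> omega
    · by_contra hsr
      split_ifs at s2 with hm
      · obtain rfl : s = i := by omega
        rw [hm.1, show s + j - s = j by omega] at s3
        exact h2 s3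
      · omega
    · rw [hmem]
      exact Or.inr ⟨s3, hs⟩

theorem _root_.PipeASM.InSlide.interlaced {D : PipeDream n} {π : Equiv.Perm (Fin n)}
    (h : InSlide π D) : D.Interlaced := by
  obtain ⟨B, hB, hBD⟩ := h
  induction hBD with
  | refl => exact hB.interlaced
  | tail _ h ih =>
    obtain ⟨i, j, h⟩ := simpleSlide_iff.mp h
    exact h.interlaced ih

/-- The number of elbow-tiles on the antidiagonal `m` in the rows from `δ` on. -/
def elbows (D : PipeDream n) (m δ : ℕ) : ℕ :=
  ((Finset.Ico δ (m + 1)).filter fun r => (r, m - r) ∉ D.crosses).card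

theorem elbows_eq (D : PipeDream n) {m δ : ℕ} (h : δ ≤ m) :
    D.elbows m δ = D.elbows m (δ + 1) + if (δ, m - δ) ∈ D.crosses then 0 else 1 := by
  have h1 : Finset.Ico δ (m + 1) = insert δ (Finset.Ico (δ + 1) (m + 1)) := by
    ext r
    simp only [Finset.mem_Ico, Finset.mem_insert]
    omega
  rw [elbows, elbows, h1, Finset.filter_insert]
  by_cases hc : (δ, m - δ) ∈ D.crosses
  · rw [if_neg (not_not.mpr hc), if_pos hc]
    rfl
  · rw [if_pos hc, if_neg hc, Finset.card_insert_of_notMem (by simp)]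

theorem elbows_le (D : PipeDream n) (m δ : ℕ) : D.elbows m δ ≤ m + 1 - δ := by
  refine (Finset.card_filter_le _ _).trans ?_
  rw [Nat.card_Ico]

theorem Interlaced.elbows_mono {D : PipeDream n} (hD : D.Interlaced) (m δ : ℕ) :
    D.elbows m δ ≤ D.elbows (m + 1) δ := by
  rcases Nat.lt_or_ge m δ with h | h
  · have := D.elbows_le m δ
    omega
  have key : ((Finset.Ico δ (m + 2)).filter fun r => (r, m + 1 - r) ∈ D.crosses).card ≤
      ((Finset.Ico δ (m + 1)).filter fun r => (r, m - r) ∈ D.crosses).card + 1 := by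
    refine card_le_card_add_one_of_interlaced fun a ha a' ha' haa => ?_
    simp only [Finset.mem_filter, Finset.mem_Ico] at ha ha' ⊢
    obtain ⟨s, h1, h2, h3⟩ := hD m a a' haa (by omega) ha.2 ha'.2
    exact ⟨s, ⟨by omega, h3⟩, h1, h2⟩
  have e1 := Finset.card_filter_add_card_filter_not (s := Finset.Ico δ (m + 2))
    (fun r => (r, m + 1 - r) ∈ D.crosses)
  have e2 := Finset.card_filter_add_card_filter_not (s := Finset.Ico δ (m + 1))
    (fun r => (r, m - r) ∈ D.crosses)
  rw [Nat.card_Ico] at e1 e2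
  rw [elbows, elbows, show m + 1 + 1 = m + 2 from rfl]
  omega

/-- The lattice path of level `k + 1`: the row in which it meets the diagonal `δ`. Its downward steps
are the elbow-tiles of the antidiagonal `n - 2 - k`; there is no such antidiagonal for `n < k + 2`. -/
def path (D : PipeDream n) (k δ : ℕ) : ℕ := if k + 2 ≤ n then D.elbows (n - 2 - k) δ else 0

theorem path_succ (D : PipeDream n) (k δ : ℕ) :
    D.path k (δ + 1) ≤ D.path k δ ∧ D.path k δ ≤ D.path k (δ + 1) + 1 := by
  unfold path
  split_ifs with h
  · rcases Nat.lt_or_ge (n - 2 - k) δ with h1 | h1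
    · have h2 := D.elbows_le (n - 2 - k) δ
      have h3 := D.elbows_le (n - 2 - k) (δ + 1)
      omega
    · rw [D.elbows_eq h1]
      split_ifs <;> omega
  · omega

theorem path_bound (D : PipeDream n) {k δ x : ℕ} (h : x < D.path k δ) : k + (x + δ) + 1 < n := by
  unfold path at h
  have := D.elbows_le (n - 2 - k) δ
  split_ifs at h <;> omega

theorem Interlaced.path_anti {D : PipeDream n} (hD : D.Interlaced) (k δ : ℕ) :
    D.path (k + 1) δ ≤ D.path k δ := by
  unfold path
  split_ifs with h1 h2
  · have := hD.elbows_mono (n - 2 - (k + 1)) δ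
    rwa [show n - 2 - (k + 1) + 1 = n - 2 - k by omega] at this
  all_goals omega

/-- The fundamental domain of the plane partition of a pipe dream. -/
def domain (D : PipeDream n) (a b k : ℕ) : Prop := min a b < D.path k (max a b - min a b)

theorem Interlaced.isFundamental {D : PipeDream n} (hD : D.Interlaced) :
    TSSCPP.IsFundamental n D.domain := by
  have hs : ∀ a b k, D.domain a b k → D.domain b a k := by
    intro a b k h
    rwa [domain, min_comm, max_comm]
  have ha : ∀ b k a, D.domain (a + 1) b k → D.domain a b k := by
    intro b k a h
    unfold domain at h ⊢
    rcases Nat.lt_or_ge a b with hab | hab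
    · have h1 := D.path_succ k (b - (a + 1))
      rw [min_eq_left (by omega), max_eq_right (by omega)] at h ⊢
      rw [show b - (a + 1) + 1 = b - a by omega] at h1
      omega
    · have h1 := D.path_succ k (a - b)
      rw [min_eq_right (by omega), max_eq_left (by omega)] at h ⊢
      rw [show a - b + 1 = a + 1 - b by omega] at h1
      omega
  have ha' : ∀ b k a a', a' ≤ a → D.domain a b k → D.domain a' b k := by
    intro b k a a' h
    induction a, h using Nat.le_induction with
    | base => exact id
    | succ a _ ih => exact fun h => ih (ha b k a h)
  have hk : ∀ a b k k', k' ≤ k → D.domain a b k → D.domain a b k' := by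
    intro a b k k' h
    induction k, h using Nat.le_induction with
    | base => exact id
    | succ k _ ih => exact fun h => ih (h.trans_le (hD.path_anti k _))
  refine ⟨hs, ?_, ?_⟩
  · intro a b k a' b' k' h1 h2 h3 h
    exact hs _ _ _ (ha' _ _ _ _ h2 (hs _ _ _ (ha' _ _ _ _ h1 (hk _ _ _ _ h3 h))))
  · intro a b k h
    have := D.path_bound h
    omega

/-- Every interlaced pipe dream is the pipe dream of a plane partition. -/
theorem Interlaced.exists_toPipeDream {D : PipeDream n} (hD : D.Interlaced) :
    ∃ T : TSSCPP n, T.toPipeDream = D := by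
  refine ⟨TSSCPP.ofFundamental hD.isFundamental, ?_⟩
  set T := TSSCPP.ofFundamental hD.isFundamental
  have hlevel : ∀ k δ, T.levelCount (k + 1) δ = D.path k δ := by
    intro k δ
    have key : ∀ x, x < T.levelCount (k + 1) δ ↔ x < D.path k δ := by
      intro x
      rw [T.lt_levelCount (by omega), Nat.succ_le_iff, TSSCPP.lt_ofFundamental, TSSCPP.BoxMem,
        if_pos (by omega), if_pos (by omega)]
      have e : D.domain (n + x - n) (n + x + δ - n) k ↔ x < D.path k δ := by
        rw [domain, min_eq_left (by omega), max_eq_right (by omega)]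
        rw [show n + x + δ - n - (n + x - n) = δ by omega, Nat.add_sub_cancel_left]
      constructor
      · rintro ⟨-, -, -, h⟩
        split_ifs at h
        exact e.mp h
      · intro h
        have := D.path_bound h
        refine ⟨by omega, by omega, by omega, ?_⟩
        rw [if_neg (by omega)]
        exact e.mpr h
    have h1 := key (T.levelCount (k + 1) δ)
    have h2 := key (D.path k δ)
    omega
  ext ⟨r, c⟩
  rw [T.mem_toPipeDream]
  have main : r + c + 1 < n → (T.levelCount (n - 1 - (r + c)) r =
      T.levelCount (n - 1 - (r + c)) (r + 1) ↔ (r, c) ∈ D.crosses) := by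
    intro h
    rw [show n - 1 - (r + c) = (n - 2 - (r + c)) + 1 by omega, hlevel, hlevel, path, path,
      if_pos (by omega), if_pos (by omega), show n - 2 - (n - 2 - (r + c)) = r + c by omega,
      D.elbows_eq (by omega), Nat.add_sub_cancel_left]
    split_ifs with hc <;> simp [hc]
  exact ⟨fun h => (main h.1).mp h.2, fun h => ⟨D.above _ h, (main (D.above _ h)).mpr h⟩⟩

end PipeDream

/-! ### The pipe dream of the Rothe bumpless pipe dream -/

section Grassmannian

variable {n : ℕ} {π : Equiv.Perm (Fin n)} {d : ℕ}

namespace GrassAt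

theorem top_le {p : Equiv.Perm ℕ} (hG : GrassAt p d) {i j : ℕ} (hij : i ≤ j) (hj : j ≤ d) :
    p i ≤ p j := by
  rcases hij.eq_or_lt with rfl | h
  · exact le_rfl
  · exact (hG.top i j h hj).le

theorem add_le {p : Equiv.Perm ℕ} (hG : GrassAt p d) {r : ℕ} (hr : r ≤ d) :
    p (d - r) + r ≤ p d := by
  induction r with
  | zero => simp
  | succ r ih =>
    have h1 := ih (by omega)
    have h2 := hG.top (d - (r + 1)) (d - r) (by omega) (by omega)
    omega

/-- Between consecutive values of the increasing run `p 0 < p 1 < … < p d` lie values of the second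
run, shifted by a constant. -/
theorem apply_gap {p : Equiv.Perm ℕ} (hG : GrassAt p d) {c x : ℕ} (hc : c ≤ d + 1)
    (h1 : ∀ s, s < c → p s < x) (h2 : c ≤ d → x < p c) : p (x + (d + 1 - c)) = x := by
  have hm : d < p.symm x := by
    by_contra hm
    rcases Nat.lt_or_ge (p.symm x) c with h | h
    · have := h1 _ h
      simp at this
    · have h3 := h2 (by omega)
      have h4 := hG.top_le h (by omega)
      simp only [Equiv.apply_symm_apply] at h4
      omega
  have hset : (Finset.range x).map p.symm.toEmbedding =
      Finset.range c ∪ Finset.Ioo d (p.symm x) := by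
    ext s
    simp only [Finset.mem_map_equiv, Equiv.symm_symm, Finset.mem_range, Finset.mem_union,
      Finset.mem_Ioo]
    rcases Nat.lt_or_ge d s with hs | hs
    · have h3 := hG.bot s (p.symm x) hs
      have h4 := hG.bot (p.symm x) s hm
      simp only [Equiv.apply_symm_apply] at h3 h4
      constructor
      · intro h5
        right
        refine ⟨hs, ?_⟩
        by_contra h6
        rcases (not_lt.mp h6).eq_or_lt with h7 | h7
        · rw [← h7] at h5
          simp at h5
        · have := h4 h7
          omega
      · rintro (h5 | h5)
        · omega
        · exact h3 h5.2
    · constructor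
      · intro h5
        left
        by_contra h6
        have h7 := h2 (by omega)
        have h8 := hG.top_le (not_lt.mp h6) hs
        omega
      · rintro (h5 | h5)
        · exact h1 s h5
        · omega
  have hcard := congrArg Finset.card hset
  rw [Finset.card_map, Finset.card_range, Finset.card_union_of_disjoint, Finset.card_range,
    Nat.card_Ioo] at hcard
  · have : x + (d + 1 - c) = p.symm x := by omega
    rw [this, Equiv.apply_symm_apply]
  · rw [Finset.disjoint_left]
    intro s hs hs'
    simp only [Finset.mem_range, Finset.mem_Ioo] at hs hs'
    omega

theorem le_apply {p : Equiv.Perm ℕ} (hG : GrassAt p d) {s : ℕ} (hs : s ≤ d) : s ≤ p s := by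
  induction s with
  | zero => exact Nat.zero_le _
  | succ s ih => exact (ih (by omega)).trans_lt (hG.top s (s + 1) (by omega) hs)

theorem lt_symm_of_gap {p : Equiv.Perm ℕ} (hG : GrassAt p d) {t l : ℕ} (h1 : p t < l)
    (h2 : l < p (t + 1)) (ht : t + 1 ≤ d) : d < p.symm l := by
  by_contra h
  rcases Nat.lt_or_ge t (p.symm l) with h3 | h3
  · have := hG.top_le (i := t + 1) h3 (by omega)
    simp only [Equiv.apply_symm_apply] at this
    omega
  · have := hG.top_le h3 (by omega)
    simp only [Equiv.apply_symm_apply] at this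
    omega

/-- The crosses of `PipeDream.top` lie above the main antidiagonal. -/
theorem add_lt (hG : GrassAt (natPerm π) d) {r j : ℕ} (hr : r ≤ d) (hj : j < natPerm π (d - r))
    (hq : d < (natPerm π).symm j) : r + j + 1 < n := by
  have h1 := hG.add_le hr
  rcases Nat.lt_or_ge j n with hjn | hjn
  · have h2 := natPerm_symm_lt π hjn
    have h3 := natPerm_lt π (i := d) (by omega)
    omega
  · have h2 : (natPerm π).symm j = j := by rw [Equiv.symm_apply_eq, natPerm_of_ge π hjn]
    rcases Nat.lt_or_ge d n with hd | hd
    · have := natPerm_lt π hd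
      omega
    · have := natPerm_of_ge π hd
      omega

end GrassAt

namespace PipeDream

/-- The pipe dream that corresponds to the Rothe bumpless pipe dream: the row of `p (d - r)` in the
Rothe diagram becomes row `r`. -/
def top (π : Equiv.Perm (Fin n)) (d : ℕ) : PipeDream n where
  crosses := (Finset.range n ×ˢ Finset.range n).filter fun c => c.1 + c.2 + 1 < n ∧
    c.1 ≤ d ∧ c.2 < natPerm π (d - c.1) ∧ d < (natPerm π).symm c.2
  above _ hp := (Finset.mem_filter.mp hp).2.1

theorem mem_top (hG : GrassAt (natPerm π) d) {r j : ℕ} : (r, j) ∈ (top π d).crosses ↔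
    r ≤ d ∧ j < natPerm π (d - r) ∧ d < (natPerm π).symm j := by
  rw [top, Finset.mem_filter, Finset.mem_product, Finset.mem_range, Finset.mem_range]
  constructor
  · exact fun h => h.2.2
  · intro h
    have := hG.add_lt h.1 h.2.1 h.2.2
    exact ⟨⟨by omega, by omega⟩, this, h⟩

/-- To the left of an elbow in a column of the first run, crosses in all other columns let the pipe
from the north of that elbow pass. -/
theorem top_side (hG : GrassAt (natPerm π) d) (hd : d < n) {r t c : ℕ} (ht : t + r ≤ d)
    (hc : c ≤ natPerm π t) (h : ∀ l, c ≤ l → l < natPerm π t → d < (natPerm π).symm l) :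
    (top π d).side r c = (top π d).northLabel r (natPerm π t) := by
  have hpn := natPerm_lt π (i := t) (by omega)
  induction hc using Nat.decreasingInduction with
  | self =>
    rw [side_eq _ _ hpn, if_neg]
    rw [mem_top hG, Equiv.symm_apply_apply]
    omega
  | of_succ c hc ih =>
    rw [side_eq _ _ (by omega), if_pos, ih fun l h1 => h l (by omega)]
    rw [mem_top hG]
    have := hG.top_le (i := t) (j := d - r) (by omega) (by omega)
    exact ⟨by omega, by omega, h c le_rfl hc⟩

/-- The labels in the first rows. The columns of the first run are shifted by one in each row, the
other columns keep their label as long as they hold crosses, and have a shifted label afterwards. -/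
theorem top_northLabel (hG : GrassAt (natPerm π) d) (hd : d < n) {r : ℕ} (hr : r ≤ d + 1) :
    (∀ t, t + r ≤ d → (top π d).northLabel r (natPerm π t) = natPerm π (t + r)) ∧
    (∀ j, d < (natPerm π).symm j → (∀ r', r' < r → j < natPerm π (d - r')) →
      (top π d).northLabel r j = j) ∧
    (∀ j, r ≠ 0 → natPerm π (d + 1 - r) ≤ j → j + r < n →
      (top π d).northLabel r j = natPerm π (j + r)) := by
  induction r with
  | zero => exact ⟨fun t _ => rfl, fun j _ _ => rfl, fun j h => absurd rfl h⟩
  | succ r ih =>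
    obtain ⟨h1, h2, h3⟩ := ih (by omega)
    refine ⟨fun t ht => ?_, fun j hj hr' => ?_, fun j _ hj hjn => ?_⟩
    · have hlt := hG.top t (t + 1) (by omega) (by omega)
      rw [northLabel_succ, if_neg, top_side hG hd (t := t + 1) (by omega) hlt, h1 (t + 1) (by omega)]
      · congr 1
        omega
      · exact fun l h4 h5 => hG.lt_symm_of_gap h4 h5 (by omega)
      · rw [mem_top hG, Equiv.symm_apply_apply]
        omega
    · rw [northLabel_succ, if_pos, h2 j hj fun r' h => hr' r' (by omega)]
      rw [mem_top hG]
      exact ⟨by omega, hr' r (by omega), hj⟩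
    · rw [Nat.add_sub_add_right] at hj
      rw [northLabel_succ, if_neg, side_eq _ _ (by omega), if_neg]
      · have hgap := hG.apply_gap (c := d + 1 - r) (x := j + 1) (by omega)
          (fun s hs => by
            have := hG.top_le (i := s) (j := d - r) (by omega) (by omega)
            omega)
        rw [show j + 1 + (d + 1 - (d + 1 - r)) = j + (r + 1) by omega] at hgap
        by_cases h4 : r ≠ 0 ∧ natPerm π (d + 1 - r) ≤ j + 1
        · rw [h3 (j + 1) h4.1 h4.2 (by omega)]
          congr 1
          omega
        · have h5 := hgap fun h => by
            by_contra h6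
            exact h4 ⟨by omega, by omega⟩
          rw [h5]
          refine h2 _ ?_ fun r' hr' => ?_
          · have h6 : (natPerm π).symm (j + 1) = j + (r + 1) := by
              rw [Equiv.symm_apply_eq]
              exact h5.symm
            have h7 := hG.le_apply (s := d - r) (by omega)
            rw [h6]
            omega
          · have := hG.top_le (i := d + 1 - r) (j := d - r') (by omega) (by omega)
            by_contra h6
            exact h4 ⟨by omega, by omega⟩
      · rw [mem_top hG]
        omega
      · rw [mem_top hG]
        omega

theorem top_hasPerm (hG : GrassAt (natPerm π) d) (hd : 0 < n → d < n) : (top π d).HasPerm π := by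
  rw [hasPerm_iff]
  intro i hi
  have hd := hd (by omega)
  rcases Nat.lt_or_ge d i with hid | hid
  · have low : ∀ r, d + 1 ≤ r → ∀ j, j + r < n →
        (top π d).northLabel r j = natPerm π (j + r) := by
      intro r hr
      induction r, hr using Nat.le_induction with
      | base =>
        obtain ⟨-, h2, h3⟩ := top_northLabel hG hd (r := d + 1) le_rfl
        intro j hj
        rcases Nat.lt_or_ge j (natPerm π 0) with h | h
        · have h4 := hG.apply_gap (c := 0) (x := j) (by omega) (by omega) (fun _ => h)
          rw [Nat.sub_zero] at h4
          rw [h4]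
          refine h2 j ?_ fun r' hr' => h.trans_le (hG.top_le (Nat.zero_le _) (by omega))
          conv_rhs => rw [← h4]
          rw [Equiv.symm_apply_apply]
          omega
        · exact h3 j (by omega) (by rwa [Nat.sub_self]) hj
      | succ r hr ih =>
        intro j hj
        rw [northLabel_succ, if_neg, side_eq _ _ (by omega), if_neg, ih (j + 1) (by omega)]
        · congr 1
          omega
        · rw [mem_top hG]
          omega
        · rw [mem_top hG]
          omega
    rw [side_eq _ _ (by omega), if_neg, low i hid 0 (by omega), Nat.zero_add]
    rw [mem_top hG]
    omega
  · rw [top_side hG hd (t := 0) (by omega) (Nat.zero_le _),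
      (top_northLabel hG hd (by omega)).1 0 (by omega), Nat.zero_add]
    intro l _ hl
    by_contra h
    have := hG.top_le (Nat.zero_le _) (not_lt.mp h)
    rw [Equiv.apply_symm_apply] at this
    omega

/-- At the cross `(r, j)` the pipe `j` meets the pipe that runs through the first column `p t > j` of the
first run; in row `r` this is the pipe `p (t + r)`. -/
theorem top_pipesAt (hG : GrassAt (natPerm π) d) (hd : d < n) {r j : ℕ}
    (h : (r, j) ∈ (top π d).crosses) : ∃ t, t + r ≤ d ∧ (∀ s, s < t → natPerm π s < j) ∧
      j < natPerm π t ∧ (top π d).pipesAt (r, j) = s(j, natPerm π (t + r)) := by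
  obtain ⟨h1, h2, h3⟩ := (mem_top hG).mp h
  have hex : ∃ t, j < natPerm π t ∧ t ≤ d - r := ⟨d - r, h2, le_rfl⟩
  classical
  obtain ⟨ht1, ht2⟩ := Nat.find_spec hex
  have hmin : ∀ s, s < Nat.find hex → natPerm π s < j := by
    intro s hs
    have h4 := Nat.find_min hex hs
    have h5 : natPerm π s ≠ j := by
      rintro rfl
      rw [Equiv.symm_apply_apply] at h3
      omega
    by_contra h6
    exact h4 ⟨by omega, by omega⟩
  refine ⟨Nat.find hex, by omega, hmin, ht1, ?_⟩
  obtain ⟨h4, h5, -⟩ := top_northLabel hG hd (r := r) (by omega)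
  rw [pipesAt_eq, h5 j h3 fun r' hr' => h2.trans_le (hG.top_le (by omega) (by omega)),
    top_side hG hd (t := Nat.find hex) (by omega) ht1, h4 _ (by omega)]
  intro l hl1 hl2
  by_contra h6
  rcases Nat.lt_or_ge ((natPerm π).symm l) (Nat.find hex) with h7 | h7
  · have := hmin _ h7
    rw [Equiv.apply_symm_apply] at this
    omega
  · have := hG.top_le h7 (by omega)
    rw [Equiv.apply_symm_apply] at this
    omega

theorem top_isReduced (hG : GrassAt (natPerm π) d) (hd : 0 < n → d < n) :
    (top π d).IsReduced := by
  rintro ⟨r, j⟩ h ⟨r', j'⟩ h' he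
  have hd := hd (by have := (top π d).above _ h; omega)
  obtain ⟨t, h1, h2, h3, h4⟩ := top_pipesAt hG hd h
  obtain ⟨t', h1', h2', h3', h4'⟩ := top_pipesAt hG hd h'
  have hj := ((mem_top hG).mp h).2.2
  have hj' := ((mem_top hG).mp h').2.2
  rw [h4, h4', Sym2.eq_iff] at he
  rcases he with ⟨rfl, he⟩ | ⟨rfl, he⟩
  · have h5 := (natPerm π).injective he
    have h6 : t = t' := by
      rcases lt_trichotomy t t' with h7 | h7 | h7
      · have := h2' _ h7
        omega
      · exact h7
      · have := h2 _ h7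
        omega
    obtain rfl : r = r' := by omega
    rfl
  · rw [Equiv.symm_apply_apply] at hj
    omega

/-! ### The bottom pipe dream is unique -/

theorem side_zero_of_leftJustified (D : PipeDream n) {i c : ℕ} (hcn : c < n)
    (h1 : ∀ l, l < c → (i, l) ∈ D.crosses) (h2 : (i, c) ∉ D.crosses) :
    D.side i 0 = D.northLabel i c := by
  have key : ∀ l, l ≤ c → D.side i l = D.northLabel i c := by
    intro l hl
    induction hl using Nat.decreasingInduction with
    | self => rw [side_eq _ _ hcn, if_neg h2]
    | of_succ l hl ih => rw [side_eq _ _ (by omega), if_pos (h1 l hl), ih]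
  exact key 0 (Nat.zero_le c)

theorem IsBottom.exists_length {D : PipeDream n} (h : D.IsBottom π) {i : ℕ} (hi : i < n) :
    ∃ c, i + c < n ∧ ∀ l, (i, l) ∈ D.crosses ↔ l < c := by
  classical
  have hex : ∃ c, (i, c) ∉ D.crosses := ⟨n, fun hc => by have := D.above _ hc; simp at this; omega⟩
  have hmin : ∀ l, l < Nat.find hex → (i, l) ∈ D.crosses := fun l hl =>
    not_not.mp (Nat.find_min hex hl)
  refine ⟨Nat.find hex, ?_, fun l => ⟨fun hl => ?_, hmin l⟩⟩
  · by_contra hc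
    have := D.above _ (hmin (n - 1 - i) (by omega))
    simp only at this
    omega
  · by_contra hc
    have key : ∀ l, Nat.find hex ≤ l → (i, l) ∉ D.crosses := by
      intro l hl
      induction l, hl using Nat.le_induction with
      | base => exact Nat.find_spec hex
      | succ l _ ih => exact fun h' => ih (h.2.2 i l h')
    exact key l (not_lt.mp hc) hl

/-- A left-justified pipe dream is determined by its permutation: the label that leaves row `i`
determines the number of crosses in row `i`. -/
theorem IsBottom.eq {D D' : PipeDream n} (h : D.IsBottom π) (h' : D'.IsBottom π) : D = D' := by
  have key : ∀ i l, (i, l) ∈ D.crosses ↔ (i, l) ∈ D'.crosses := by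
    intro i
    induction i using Nat.strong_induction_on with
    | _ i ih =>
      intro l
      rcases Nat.lt_or_ge i n with hi | hi
      · obtain ⟨c, hc, hm⟩ := h.exists_length hi
        obtain ⟨c', hc', hm'⟩ := h'.exists_length hi
        have hN := northLabel_congr_down (D := D) (D' := D') (Nat.zero_le i) (fun _ _ => rfl)
          fun k' _ hk l => (ih k' hk l).symm
        have e1 := side_zero_of_leftJustified D (i := i) (c := c) (by omega)
          (fun l hl => (hm l).mpr hl) (by rw [hm]; omega)
        have e2 := side_zero_of_leftJustified D' (i := i) (c := c') (by omega)
          (fun l hl => (hm' l).mpr hl) (by rw [hm']; omega)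
        rw [(hasPerm_iff D π).mp h.2.1 i hi] at e1
        rw [(hasPerm_iff D' π).mp h'.2.1 i hi, hN c' (by omega), e1, northLabel_eq_state _ hc,
          northLabel_eq_state _ hc'] at e2
        have := (D.state (i * n)).injective e2
        obtain rfl : c = c' := by omega
        rw [hm, hm']
      · constructor
        · intro hc
          have := D.above _ hc
          simp only at this
          omega
        · intro hc
          have := D'.above _ hc
          simp only at this
          omega
  ext ⟨i, l⟩
  exact key i l

end PipeDream

/-! ### Droops correspond to slides -/

/-- The cross-tiles of `P` are the blank tiles of `D`, reflected vertically inside the rows up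
to `d`. -/
def Matched (d : ℕ) (D : BPD n) (P : PipeDream n) : Prop :=
  ∀ i j, (i, j) ∈ P.crosses ↔ i ≤ d ∧ (d - i, j) ∈ D.blanks

theorem matched_rothe (hG : GrassAt (natPerm π) d) :
    Matched d (BPD.rothe π) (PipeDream.top π d) := by
  intro i j
  rw [PipeDream.mem_top hG, BPD.mem_blanks]
  refine and_congr_right fun hi => ?_
  have hiff : natPerm π (d - i) = j ↔ (natPerm π).symm j = d - i := by
    rw [Equiv.symm_apply_eq, eq_comm]
  constructor
  · rintro ⟨h1, h2⟩
    have h3 := hG.add_lt hi h1 h2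
    have h4 : d - i < n := by
      have := natPerm_symm_lt π (i := j) (by omega)
      omega
    refine ⟨⟨h4, by omega⟩, ?_⟩
    rw [BPD.rothe_tile π h4 (by omega), BPD.rotheTile, if_neg (by omega), if_neg (by omega),
      if_neg (by omega)]
  · rintro ⟨⟨h1, h2⟩, h3⟩
    rw [BPD.rothe_tile π h1 h2, BPD.rotheTile] at h3
    split_ifs at h3 with h4 h5 h6 h7
    refine ⟨by omega, ?_⟩
    by_contra h8
    have h9 := hG.top (d - i) _ (by omega) (not_lt.mp h8)
    rw [Equiv.apply_symm_apply] at h9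
    omega

theorem Matched.of_droopAt {D D' : BPD n} {P P' : PipeDream n} {i₀ i j : ℕ} (hd : i₀ + i + 1 = d)
    (hD : DroopAt D D' i j) (hP : SlideAt P' P i₀ j) (h : Matched d D P) : Matched d D' P' := by
  intro k l
  have h1 := h k l
  rw [BPD.mem_blanks] at h1 ⊢
  have h2 := hD.1
  have h3 := hD.2.1
  by_cases a : k = i₀ + 1 ∧ l = j
  · obtain ⟨rfl, rfl⟩ := a
    have e : d - (i₀ + 1) = i := by omega
    rw [e, hD.blank_iff]
    exact iff_of_true hP.1 ⟨by omega, ⟨by omega, by omega⟩, Or.inl ⟨rfl, rfl⟩⟩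
  by_cases b : k = i₀ ∧ l = j + 1
  · obtain ⟨rfl, rfl⟩ := b
    have e : d - k = i + 1 := by omega
    rw [e, hD.blank_iff]
    refine iff_of_false hP.2.2.1 ?_
    rintro ⟨-, -, h4 | h4⟩
    · omega
    · exact h4.2 ⟨rfl, rfl⟩
  · have e0 : (k, l) ∈ P.crosses ↔ (k, l) ∈ P'.crosses := by
      rw [hP.mem_iff]
      exact ⟨fun h => h.elim (fun h => absurd h b) And.left, fun h => Or.inr ⟨h, a⟩⟩
    rw [← e0, h1]
    refine and_congr_right fun hk => and_congr_right fun _ => ?_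
    rw [hD.blank_iff]
    exact ⟨fun h => Or.inr ⟨h, by omega⟩, fun h => h.elim (fun h => by omega) And.left⟩

theorem Matched.of_droopAt' {D D' : BPD n} {P P' : PipeDream n} {i₀ i j : ℕ} (hd : i₀ + i + 1 = d)
    (hD : DroopAt D D' i j) (hP : SlideAt P' P i₀ j) (h : Matched d D' P') : Matched d D P := by
  intro k l
  have h1 := h k l
  rw [BPD.mem_blanks] at h1 ⊢
  have h2 := hD.1
  have h3 := hD.2.1
  by_cases a : k = i₀ ∧ l = j + 1
  · obtain ⟨rfl, rfl⟩ := a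
    have e : d - k = i + 1 := by omega
    rw [e, hP.mem_iff]
    exact iff_of_true (Or.inl ⟨rfl, rfl⟩) ⟨by omega, ⟨h2, h3⟩, hD.2.2.2.2.1⟩
  by_cases b : k = i₀ + 1 ∧ l = j
  · obtain ⟨rfl, rfl⟩ := b
    have e : d - (i₀ + 1) = i := by omega
    rw [e, hP.mem_iff]
    refine iff_of_false (fun h => ?_) fun h => ?_
    · exact h.elim (fun h => by omega) fun h => h.2 ⟨rfl, rfl⟩
    · exact absurd (hD.2.2.1.symm.trans h.2.2) (by decide)
  · have e0 : (k, l) ∈ P.crosses ↔ (k, l) ∈ P'.crosses := by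
      rw [hP.mem_iff]
      exact ⟨fun h => h.elim (fun h => absurd h a) And.left, fun h => Or.inr ⟨h, b⟩⟩
    rw [e0, h1]
    refine and_congr_right fun hk => and_congr_right fun _ => ?_
    rw [hD.blank_iff]
    exact ⟨fun h => h.elim (fun h => by omega) And.left, fun h => Or.inr ⟨h, by omega⟩⟩

/-- A droop takes place in a square whose only blank tile is in the south-east; the reflected square of
a matched pipe dream has its only cross in the north-east. -/
theorem Matched.exists_slide {D D' : BPD n} {P : PipeDream n} (h : Matched d D P)
    (hG : GrassAt (natPerm π) d) (hD : D.HasPerm π) (hDD : SimpleDroop D D') :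
    ∃ P', SimpleSlide P' P ∧ Matched d D' P' := by
  obtain ⟨i, j, hDD⟩ := simpleDroop_iff.mp hDD
  have hDD' := hDD
  obtain ⟨hi, hj, h1, h2, h3, h4, h5, h6, h7⟩ := hDD'
  have hid := hD.le_of_mem_blanks hG (BPD.mem_blanks.mpr ⟨⟨hi, hj⟩, h3⟩)
  have e1 : d - (d - (i + 1)) = i + 1 := by omega
  have e2 : d - (d - (i + 1) + 1) = i := by omega
  have m1 : (d - (i + 1), j + 1) ∈ P.crosses := by
    rw [h, e1, BPD.mem_blanks]
    exact ⟨by omega, ⟨hi, hj⟩, h3⟩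
  have m2 : (d - (i + 1), j) ∉ P.crosses := by
    rw [h, e1, BPD.mem_blanks]
    rcases h5 with h5 | h5 <;> simp [h5.1]
  have m3 : (d - (i + 1) + 1, j) ∉ P.crosses := by
    rw [h, e2, BPD.mem_blanks]
    simp [h1]
  have m4 : (d - (i + 1) + 1, j + 1) ∉ P.crosses := by
    rw [h, e2, BPD.mem_blanks]
    rcases h6 with h6 | h6 <;> simp [h6.1]
  have hslide : ∃ P', SlideAt P' P (d - (i + 1)) j := by
    refine ⟨⟨insert (d - (i + 1) + 1, j) (P.crosses.erase (d - (i + 1), j + 1)), ?_⟩,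
      by simp, by simp [m2], by simp, by simp [m4], ?_⟩
    · intro p hp
      have := P.above _ m1
      rcases Finset.mem_insert.mp hp with rfl | hp
      · simp only at this ⊢
        omega
      · exact P.above p (Finset.mem_of_mem_erase hp)
    · rw [Finset.erase_insert (by simp [m3]), Finset.insert_erase m1]
  obtain ⟨P', hP'⟩ := hslide
  exact ⟨P', ⟨_, _, hP'⟩, h.of_droopAt (by omega) hDD hP'⟩

/-- In a crossing-free square whose only blank tile is in the south-east, the other three tiles are as
a droop requires. -/
theorem Matched.exists_droop {D : BPD n} {P P' : PipeDream n} (h : Matched d D P)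
    (hG : GrassAt (natPerm π) d) (hD : D.HasPerm π) (hPP : SimpleSlide P' P) :
    ∃ D', SimpleDroop D D' ∧ Matched d D' P' := by
  obtain ⟨i₀, j, hPP⟩ := simpleSlide_iff.mp hPP
  have hmem : ∀ k l, (k, l) ∈ P.crosses ↔ _ := fun k l => hPP.mem_iff
  obtain ⟨s1, s2, s3, s4, -⟩ := id hPP
  have m1 := (h i₀ (j + 1)).mp (by rw [hmem]; simp)
  have m2 := mt (h i₀ j).mpr (by rw [hmem]; simp [s2])
  have m3 := mt (h (i₀ + 1) j).mpr (by rw [hmem]; simp)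
  have m4 := mt (h (i₀ + 1) (j + 1)).mpr (by rw [hmem]; simp [s4])
  obtain ⟨hi₀, m1⟩ := m1
  obtain ⟨⟨hi, hj⟩, b1⟩ := BPD.mem_blanks.mp m1
  have b2 : D.tile (d - i₀) j ≠ .blank := fun hb =>
    m2 ⟨hi₀, BPD.mem_blanks.mpr ⟨⟨hi, by omega⟩, hb⟩⟩
  have c1 := hD.no_cross hG (i := d - i₀) (j := j) (by omega) hi (by omega)
  have e1 := D.match_horizontal (d - i₀) j hi hj
  rw [b1, BTile.west_blank] at e1
  -- in the top row, a blank tile cannot follow a pipe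
  have hid : i₀ + 1 ≤ d := by
    by_contra hid
    have e2 := D.border_north j (by omega)
    rw [show (0 : ℕ) = d - i₀ by omega] at e2
    revert b2 c1 e1 e2
    cases D.tile (d - i₀) j <;> simp
  obtain ⟨i, hi'⟩ : ∃ i, i₀ + i + 1 = d := ⟨d - i₀ - 1, by omega⟩
  have r1 : d - i₀ = i + 1 := by omega
  have r2 : d - (i₀ + 1) = i := by omega
  rw [r1] at b1 b2 c1 e1 hi
  rw [r2] at m3 m4
  have b3 : D.tile i j ≠ .blank := fun hb =>
    m3 ⟨hid, BPD.mem_blanks.mpr ⟨⟨by omega, by omega⟩, hb⟩⟩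
  have b4 : D.tile i (j + 1) ≠ .blank := fun hb =>
    m4 ⟨hid, BPD.mem_blanks.mpr ⟨⟨by omega, by omega⟩, hb⟩⟩
  have c3 := hD.no_cross hG (i := i) (j := j) (by omega) (by omega) (by omega)
  have c4 := hD.no_cross hG (i := i) (j := j + 1) (by omega) (by omega) (by omega)
  have e2 := D.match_vertical i (j + 1) hi hj
  rw [b1, BTile.north_blank] at e2
  have t1 : D.tile (i + 1) j = .vertical ∨ D.tile (i + 1) j = .jElbow := by
    revert b2 c1 e1
    cases D.tile (i + 1) j <;> simp
  have t2 : D.tile i (j + 1) = .horizontal ∨ D.tile i (j + 1) = .jElbow := by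
    revert b4 c4 e2
    cases D.tile i (j + 1) <;> simp
  have e3 : (D.tile i j).east = true := by
    rw [D.match_horizontal i j (by omega) hj]
    rcases t2 with t2 | t2 <;> simp [t2]
  have e4 : (D.tile i j).south = true := by
    rw [D.match_vertical i j hi (by omega)]
    rcases t1 with t1 | t1 <;> simp [t1]
  have t3 : D.tile i j = .rElbow := by
    revert b3 c3 e3 e4
    cases D.tile i j <;> simp
  obtain ⟨D', hD'⟩ := D.exists_droopAt hi hj t3 b1 t1 t2
  exact ⟨D', ⟨_, _, hD'⟩, h.of_droopAt hi' hD' hPP⟩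

/-- In a crossing-free square whose only blank tile is in the north-west, the other three tiles are as
an inverse droop requires. -/
theorem Matched.exists_undroop {D' : BPD n} {P P' : PipeDream n} (h : Matched d D' P')
    (hG : GrassAt (natPerm π) d) (hd : 0 < n → d < n) (hD : D'.HasPerm π)
    (hPP : SimpleSlide P' P) : ∃ D, SimpleDroop D D' ∧ Matched d D P := by
  obtain ⟨i₀, j, hPP⟩ := simpleSlide_iff.mp hPP
  obtain ⟨s1, s2, s3, s4, -⟩ := id hPP
  obtain ⟨hid, m1⟩ := (h (i₀ + 1) j).mp s1
  have hn := P'.above _ s1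
  simp only at hn
  have hd := hd (by omega)
  have m2 := mt (h i₀ j).mpr s2
  have m3 := mt (h i₀ (j + 1)).mpr s3
  have m4 := mt (h (i₀ + 1) (j + 1)).mpr s4
  obtain ⟨i, hi'⟩ : ∃ i, i₀ + i + 1 = d := ⟨d - i₀ - 1, by omega⟩
  have r1 : d - i₀ = i + 1 := by omega
  have r2 : d - (i₀ + 1) = i := by omega
  rw [r2] at m1 m4
  rw [r1] at m2 m3
  have hi : i + 1 < n := by omega
  have hj : j + 1 < n := by omega
  obtain ⟨-, b1⟩ := BPD.mem_blanks.mp m1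
  have b2 : D'.tile (i + 1) j ≠ .blank := fun hb =>
    m2 ⟨by omega, BPD.mem_blanks.mpr ⟨⟨hi, by omega⟩, hb⟩⟩
  have b4 : D'.tile i (j + 1) ≠ .blank := fun hb =>
    m4 ⟨by omega, BPD.mem_blanks.mpr ⟨⟨by omega, by omega⟩, hb⟩⟩
  have c2 := hD.no_cross hG (i := i + 1) (j := j) (by omega) (by omega) (by omega)
  have c3 := hD.no_cross hG (i := i + 1) (j := j + 1) (by omega) (by omega) (by omega)
  have c4 := hD.no_cross hG (i := i) (j := j + 1) (by omega) (by omega) (by omega)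
  have e1 := D'.match_horizontal i j (by omega) hj
  have e2 := D'.match_vertical i j hi (by omega)
  rw [b1, BTile.east_blank] at e1
  rw [b1, BTile.south_blank] at e2
  have t1 : D'.tile (i + 1) j = .rElbow ∨ D'.tile (i + 1) j = .horizontal := by
    revert b2 c2 e2
    cases D'.tile (i + 1) j <;> simp
  have t2 : D'.tile i (j + 1) = .rElbow ∨ D'.tile i (j + 1) = .vertical := by
    revert b4 c4 e1
    cases D'.tile i (j + 1) <;> simp
  have e3 : (D'.tile (i + 1) (j + 1)).west = true := by
    rw [← D'.match_horizontal (i + 1) j hi hj]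
    rcases t1 with t1 | t1 <;> simp [t1]
  have e4 : (D'.tile (i + 1) (j + 1)).north = true := by
    rw [← D'.match_vertical i (j + 1) hi hj]
    rcases t2 with t2 | t2 <;> simp [t2]
  have t3 : D'.tile (i + 1) (j + 1) = .jElbow := by
    revert c3 e3 e4
    cases D'.tile (i + 1) (j + 1) <;> simp
  obtain ⟨D, hDD⟩ := D'.exists_undroopAt hi hj b1 t3 t1 t2
  exact ⟨D, ⟨_, _, hDD⟩, h.of_droopAt' hi' hDD hPP⟩

theorem Matched.pipeDream_eq {D : BPD n} {P P' : PipeDream n} (h : Matched d D P)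
    (h' : Matched d D P') : P = P' := by
  ext ⟨i, j⟩
  rw [h i j, h' i j]

theorem Matched.bpd_eq {D D' : BPD n} {P : PipeDream n} (h : Matched d D P) (h' : Matched d D' P)
    (hG : GrassAt (natPerm π) d) (hD : D.HasPerm π) (hD' : D'.HasPerm π) : D = D' := by
  refine hD.ext_blanks hD' hG fun i j hi => ?_
  have h1 := h (d - i) j
  have h2 := h' (d - i) j
  rw [Nat.sub_sub_self hi] at h1 h2
  rw [h1] at h2
  simpa using h2

theorem Matched.image_blanks {D : BPD n} {P : PipeDream n} (h : Matched d D P)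
    (hb : ∀ p ∈ D.blanks, p.1 ≤ d) : P.crosses = D.blanks.image fun p => (d - p.1, p.2) := by
  ext ⟨i, j⟩
  rw [h i j, Finset.mem_image]
  constructor
  · intro ⟨h1, h2⟩
    exact ⟨_, h2, by rw [Nat.sub_sub_self h1]⟩
  · rintro ⟨⟨k, l⟩, h1, h2⟩
    obtain ⟨rfl, rfl⟩ := Prod.mk.inj h2
    exact ⟨Nat.sub_le _ _, by rwa [Nat.sub_sub_self (hb _ h1)]⟩

/-- Chains of droops lift to chains of slides in the opposite direction. -/
theorem Matched.exists_slides {D D' : BPD n} {P : PipeDream n} (h : Matched d D P)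
    (hG : GrassAt (natPerm π) d) (hD : D.HasPerm π) (hDD : Relation.ReflTransGen SimpleDroop D D') :
    ∃ P', Relation.ReflTransGen SimpleSlide P' P ∧ Matched d D' P' ∧ D'.HasPerm π := by
  induction hDD with
  | refl => exact ⟨P, .refl, h, hD⟩
  | tail _ hs ih =>
    obtain ⟨P', h1, h2, h3⟩ := ih
    obtain ⟨P'', h4, h5⟩ := h2.exists_slide hG h3 hs
    exact ⟨P'', h1.head h4, h5, (hs.hasPerm_iff π).mpr h3⟩

theorem Matched.exists_droops {D : BPD n} {P P' : PipeDream n} (h : Matched d D P)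
    (hG : GrassAt (natPerm π) d) (hD : D.HasPerm π) (hPP : Relation.ReflTransGen SimpleSlide P' P) :
    ∃ D', Relation.ReflTransGen SimpleDroop D D' ∧ Matched d D' P' ∧ D'.HasPerm π := by
  induction hPP using Relation.ReflTransGen.head_induction_on with
  | refl => exact ⟨D, .refl, h, hD⟩
  | head hs _ ih =>
    obtain ⟨D', h1, h2, h3⟩ := ih
    obtain ⟨D'', h4, h5⟩ := h2.exists_droop hG h3 hs
    exact ⟨D'', h1.tail h4, h5, (h4.hasPerm_iff π).mpr h3⟩

theorem Matched.exists_undroops {D' : BPD n} {P P' : PipeDream n} (h : Matched d D' P')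
    (hG : GrassAt (natPerm π) d) (hd : 0 < n → d < n) (hD : D'.HasPerm π)
    (hPP : Relation.ReflTransGen SimpleSlide P' P) : ∃ D, Matched d D P ∧ D.HasPerm π := by
  induction hPP with
  | refl => exact ⟨D', h, hD⟩
  | tail _ hs ih =>
    obtain ⟨D, h1, h2⟩ := ih
    obtain ⟨D'', h3, h4⟩ := h1.exists_undroop hG hd h2 hs
    exact ⟨D'', h4, (h3.hasPerm_iff π).mp h2⟩

theorem exists_matched_pipeDream (hG : GrassAt (natPerm π) d) (hd : 0 < n → d < n) {D : BPD n}
    (hD : InDroop π D) : ∃ P, InSlide π P ∧ Matched d D P := by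
  obtain ⟨R, hR, hRD⟩ := hD
  obtain rfl := hR.eq_rothe
  obtain ⟨P, h1, h2, -⟩ := (matched_rothe hG).exists_slides hG (BPD.rothe_hasPerm π) hRD
  refine ⟨P, ?_, h2⟩
  rw [PipeDream.inSlide_iff hG]
  clear h2 hRD
  induction h1 using Relation.ReflTransGen.head_induction_on with
  | refl => exact ⟨PipeDream.top_isReduced hG hd, PipeDream.top_hasPerm hG hd⟩
  | head hs _ ih => exact ⟨hs.isReduced_iff.mp ih.1, (hs.hasPerm_iff π).mp ih.2⟩

/-- Both `P` and the pipe dream of the Rothe bumpless pipe dream lie above the bottom pipe dream, so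
they are connected by slides. -/
theorem exists_matched_bpd (hG : GrassAt (natPerm π) d) (hd : 0 < n → d < n) {P : PipeDream n}
    (hP : InSlide π P) : ∃ D, InDroop π D ∧ Matched d D P := by
  obtain ⟨B, hB, hBP⟩ := hP
  obtain ⟨B', hB', hBT⟩ := (PipeDream.inSlide_iff hG (PipeDream.top π d)).mpr
    ⟨PipeDream.top_isReduced hG hd, PipeDream.top_hasPerm hG hd⟩
  obtain rfl := hB.eq hB'
  obtain ⟨D, -, h1, h2⟩ := (matched_rothe hG).exists_droops hG (BPD.rothe_hasPerm π) hBT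
  obtain ⟨D', h3, h4⟩ := h1.exists_undroops hG hd h2 hBP
  exact ⟨D', (BPD.hasPerm_iff_inDroop hG D').mp h4, h3⟩

/-- The isomorphism between `droop(π)` and the dual of `slide(π)`. -/
theorem exists_orderIso (hG : GrassAt (natPerm π) d) (hd : 0 < n → d < n) :
    ∃ F : DroopPoset π ≃o (SlidePoset π)ᵒᵈ,
      ∀ D : DroopPoset π, Matched d D.1 (OrderDual.ofDual (F D)).1 := by
  have hperm : ∀ D : DroopPoset π, D.1.HasPerm π := fun D =>
    (BPD.hasPerm_iff_inDroop hG D.1).mpr D.2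
  have h1 : ∀ D : DroopPoset π, ∃ P : SlidePoset π, Matched d D.1 P.1 := fun D => by
    obtain ⟨P, h, h'⟩ := exists_matched_pipeDream hG hd D.2
    exact ⟨⟨P, h⟩, h'⟩
  have h2 : ∀ P : SlidePoset π, ∃ D : DroopPoset π, Matched d D.1 P.1 := fun P => by
    obtain ⟨D, h, h'⟩ := exists_matched_bpd hG hd P.2
    exact ⟨⟨D, h⟩, h'⟩
  choose φ hφ using h1
  choose ψ hψ using h2
  refine ⟨{ toFun := fun D => OrderDual.toDual (φ D)
            invFun := fun P => ψ (OrderDual.ofDual P)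
            left_inv := fun D => Subtype.ext ((hψ _).bpd_eq (hφ D) hG (hperm _) (hperm _))
            right_inv := fun P => Subtype.ext ((hφ _).pipeDream_eq (hψ (OrderDual.ofDual P)))
            map_rel_iff' := ?_ }, hφ⟩
  intro D D'
  change Relation.ReflTransGen SimpleSlide (φ D').1 (φ D).1 ↔
    Relation.ReflTransGen SimpleDroop D.1 D'.1
  constructor
  · intro h
    obtain ⟨D'', h3, h4, h5⟩ := (hφ D).exists_droops hG (hperm D) h
    rwa [h4.bpd_eq (hφ D') hG h5 (hperm D')] at h3
  · intro h
    obtain ⟨P, h3, h4, -⟩ := (hφ D).exists_slides hG (hperm D) h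
    rwa [h4.pipeDream_eq (hφ D')] at h3

/-! ### Alternating sign matrices and plane partitions -/

/-- Alternating sign matrices with permutation `π` are the same as bumpless pipe dreams
in `droop(π)`. -/
theorem exists_asm_equiv (hG : GrassAt (natPerm π) d) : ∃ e : DroopPoset π ≃ ASMOf π,
    ∀ D : DroopPoset π, (e D).1.1 = D.1.toMatrix := by
  let e : DroopPoset π → ASMOf π := fun D =>
    ⟨⟨D.1.toMatrix, D.1.isASM_toMatrix⟩, D.1, rfl, (BPD.hasPerm_iff_inDroop hG D.1).mpr D.2⟩
  refine ⟨Equiv.ofBijective e ⟨fun D D' h => ?_, fun A => ?_⟩, fun D => rfl⟩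
  · exact Subtype.ext (BPD.toMatrix_injective (congrArg (fun A : ASMOf π => A.1.1) h))
  · obtain ⟨D, h1, h2⟩ := A.2
    exact ⟨⟨D, (BPD.hasPerm_iff_inDroop hG D).mp h2⟩, Subtype.ext (Subtype.ext h1)⟩

/-- The plane partitions whose pipe dream is reduced with permutation `π` are the same as the pipe
dreams in `slide(π)`. -/
theorem exists_tsscpp_equiv (hG : GrassAt (natPerm π) d) : ∃ e : TSSCPPRed π ≃ SlidePoset π,
    ∀ T : TSSCPPRed π, (e T).1 = T.1.toPipeDream := by
  let e : TSSCPPRed π → SlidePoset π := fun T =>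
    ⟨T.1.toPipeDream, (PipeDream.inSlide_iff hG _).mpr T.2⟩
  refine ⟨Equiv.ofBijective e ⟨fun T T' h => ?_, fun P => ?_⟩, fun D => rfl⟩
  · exact Subtype.ext (TSSCPP.toPipeDream_injective (congrArg Subtype.val h))
  · obtain ⟨T, hT⟩ := P.2.interlaced.exists_toPipeDream
    have h := (PipeDream.inSlide_iff hG _).mp P.2
    rw [← hT] at h
    exact ⟨⟨T, h⟩, Subtype.ext hT⟩

theorem IsGrassmannian.exists_grassAt (hπ : IsGrassmannian π) :
    ∃ d, (0 < n → d < n) ∧ GrassAt (natPerm π) d ∧ ∀ d', IsDescent π d' → d' = d := by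
  by_cases h : ∃ d, IsDescent π d
  · obtain ⟨d, hd⟩ := h
    exact ⟨d, fun _ => by obtain ⟨h, -⟩ := hd; omega, hπ.grassAt hd, fun d' hd' => hπ d' d hd' hd⟩
  · push Not at h
    exact ⟨0, id, grassAt_of_no_descent h, fun d' hd' => absurd hd' (h d')⟩

end Grassmannian

end PipeASM

theorem mainTheorem9 (n : ℕ) (π : Equiv.Perm (Fin n)) (hπ : PipeASM.IsGrassmannian π) :
    ∃ (f : PipeASM.ASMOf π ≃ PipeASM.TSSCPPRed π)
      (F : PipeASM.DroopPoset π ≃o (PipeASM.SlidePoset π)ᵒᵈ),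
      (∀ (A : PipeASM.ASMOf π) (D : PipeASM.BPD n), D.toMatrix = A.1.1 →
        ∃ hD : PipeASM.InDroop π D,
          (OrderDual.ofDual (F ⟨D, hD⟩)).1 = (f A).1.toPipeDream) ∧
      (∀ D : PipeASM.DroopPoset π, ∃ A : PipeASM.ASMOf π, D.1.toMatrix = A.1.1) ∧
      (∀ d : ℕ, PipeASM.IsDescent π d → ∀ D : PipeASM.DroopPoset π,
        (∀ p ∈ D.1.blanks, p.1 ≤ d) ∧
        (OrderDual.ofDual (F D)).1.crosses = D.1.blanks.image fun p => (d - p.1, p.2)) := by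
  obtain ⟨d, hd, hG, hdesc⟩ := hπ.exists_grassAt
  obtain ⟨F, hF⟩ := PipeASM.exists_orderIso hG hd
  obtain ⟨a, ha⟩ := PipeASM.exists_asm_equiv hG
  obtain ⟨b, hb⟩ := PipeASM.exists_tsscpp_equiv hG
  refine ⟨a.symm.trans (F.toEquiv.trans (OrderDual.ofDual.trans b.symm)), F, ?_, ?_, ?_⟩
  · intro A D hDA
    have hA : (a.symm A).1 = D := PipeASM.BPD.toMatrix_injective (by
      rw [hDA, ← ha, Equiv.apply_symm_apply])
    subst hA
    refine ⟨(a.symm A).2, ?_⟩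
    rw [← hb]
    change _ = (b (b.symm (OrderDual.ofDual (F (a.symm A))))).1
    rw [Equiv.apply_symm_apply]
    rfl
  · exact fun D => ⟨a D, (ha D).symm⟩
  · intro d' hd' D
    obtain rfl := hdesc d' hd'
    have hbl : ∀ p ∈ D.1.blanks, p.1 ≤ d' := fun p hp =>
      ((PipeASM.BPD.hasPerm_iff_inDroop hG D.1).mpr D.2).le_of_mem_blanks hG (i := p.1) (j := p.2) hp
    exact ⟨hbl, (hF D).image_blanks hbl⟩
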